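/- Let $h_0,h_1,h_2$, $c_{T,1},\dots,c_{T,L_T}$ and $c_{R,1},\dots,c_{R,L_R}$ ($L_T,L_R\ge 1$) be independent circularly symmetric complex Gaussian random variables (Rayleigh fading), $h_i\sim\mathcal{CN}(0,\Omega_i)$, $c_{N,k}\sim\mathcal{CN}(0,\Omega_{N,k})$ for $N\in\{T,R\}$, with positive variances. Let $P,P_{I,T},P_{I,R}>0$, and let $\omega_1,\omega_2\in(0,1)$ with $\omega_1+\omega_2=1$. Put $\gamma_i=P|h_i|^2$, $\bar\gamma_i=\mathbb E\gamma_i$, $\Gamma_N=\sum_{k=1}^{L_N}P_{I,N}|c_{N,k}|^2$, $\xi_{N,k}=P_{I,N}\Omega_{N,k}$, and assume $\xi_{N,i}\neq\xi_{N,k}$ for $i\ne k$. Let $$\Upsilon=\frac{\gamma_0}{\Gamma_T+1}+\min\left\{\frac{\gamma_1}{\Gamma_T+1},\ \frac{\omega_2\gamma_2}{\Gamma_R+\omega_1\Gamma_T+\omega_1+1}\right\}$$ be the SINR upper bound at terminal 1. Define $$\phi_{N,k}=\frac1{\xi_{N,k}}\prod_{i\ne k}\frac{\xi_{N,k}}{\xi_{N,k}-\xi_{N,i}},\qquad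 \Phi_i=\frac1{\bar\gamma_0}-\frac1{\bar\gamma_1}-\frac{\omega_1+i-1}{\omega_2\bar\gamma_2},\qquad \lambda_i=\frac1{\bar\gamma_1}+\frac{\omega_1+i-1}{\omega_2\bar\gamma_2},\qquad \beta_{j,k}=\frac{\omega_2\bar\gamma_2\Phi_1}{\xi_{R,k}}+\frac1{\xi_{T,j}},$$ so that $\sum_k\phi_{N,k}e^{-t/\xi_{N,k}}$ $(t>0)$ is the density of $\Gamma_N$, and, with $\mathbb L(s,x)=\int_0^x t^{s-1}e^{-t}\,dt$ the lower incomplete gamma function, $$\mathrm M_{j,k}(\rho_1,\dots,\rho_5)=\frac{\rho_1e^{-\lambda_2\gamma}}{\rho_3}\Big(\frac{\gamma}{\bar\gamma_0}+\beta_{j,k}\Big)^{-\rho_2}\sum_{l=0}^\infty(-1)^l\Big(\frac{\rho_3}{\rho_4\gamma+\rho_5}\Big)^{l+1}\Phi_2^{-l-1}\,\mathbb L(l+1,\Phi_2\gamma),$$ $$\Lambda_{j,k}(\rho_1,\rho_2)=\frac{\bar\gamma_2}{\frac{\gamma}{\bar\gamma_0}+\beta_{j,k}}\cdot\frac{e^{-\rho_2\gamma}}{\rho_1\gamma+\frac1{\xi_{T,j}}}.$$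 Let $\gamma\ge0$ with $\gamma/\bar\gamma_0+\beta_{j,k}\ne0$ for all $j,k$, and consider the closed form for the CDF of $\Upsilon$, $$F_\Upsilon(\gamma)=1-e^{-\gamma/\bar\gamma_0}\sum_j\phi_{T,j}\frac{\bar\gamma_0}{\gamma+\bar\gamma_0/\xi_{T,j}}-\frac{\omega_2}{\bar\gamma_0}\sum_j\sum_k\phi_{T,j}\phi_{R,k}\Big(\mathrm M_{j,k}\big(1,1,-\tfrac1{\bar\gamma_2},\tfrac1{\bar\gamma_2},\tfrac{\omega_2}{\xi_{R,k}}\big)+\mathrm M_{j,k}\big(1,2,-\tfrac1{\bar\gamma_2},\tfrac1{\bar\gamma_2},\tfrac{\omega_2}{\xi_{R,k}}\big)$$ $$\qquad+\mathrm M_{j,k}\big(\tfrac1{\omega_2},1,\Phi_1,\lambda_1,\tfrac1{\xi_{T,j}}\big)+\mathrm M_{j,k}\big(\Phi_1\bar\gamma_2,2,\Phi_1,\lambda_1,\tfrac1{\xi_{T,j}}\big)+\Lambda_{j,k}(\lambda_1,\lambda_2)-\Lambda_{j,k}\big(\tfrac1{\bar\gamma_0},\tfrac1{\bar\gamma_0}\big)\Big).\qquad(*)$$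 (a) Suppose $\Phi_1\ne0$ and $\Phi_2\neq0$. The series in the first two $\mathrm M$-terms converges for every $k$; the series in the last two $\mathrm M$-terms converges for a given $j$ if and only if $\Phi_1\gamma\le\lambda_1\gamma+1/\xi_{T,j}$; and if this inequality holds for all $j$, then $(*)$ holds. (b) With no condition on $\Phi_1,\Phi_2$ or on convergence, $(*)$ holds with $\mathrm M_{j,k}(\rho_1,\dots,\rho_5)$ replaced by $$\rho_1e^{-\lambda_2\gamma}\Big(\frac{\gamma}{\bar\gamma_0}+\beta_{j,k}\Big)^{-\rho_2}\int_0^\gamma\frac{e^{-\Phi_2z}}{\rho_3z+\rho_4\gamma+\rho_5}\,dz .$$ -/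

import Mathlib

open MeasureTheory ProbabilityTheory
open scoped NNReal

noncomputable section

namespace TwoWayRelay

/-- The circularly symmetric complex Gaussian law `CN(0, v)`: real and imaginary part are
independent, centred real Gaussians of variance `v / 2` each. -/
def complexGaussian (v : ℝ≥0) : Measure ℂ :=
  ((gaussianReal 0 (v / 2)).prod (gaussianReal 0 (v / 2))).map
    (fun p : ℝ × ℝ => (⟨p.1, p.2⟩ : ℂ))

/-- The instantaneous power `p |c|²` received over a channel with coefficient `c`
at transmit power `p`. -/
def power (p : ℝ) (c : ℂ) : ℝ := p * ‖c‖ ^ 2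

/-- The total interference power `Γ = ∑ₖ p |cₖ|²` at a node. -/
def interference {L : ℕ} (p : ℝ) (c : Fin L → ℂ) : ℝ := ∑ k, power p (c k)

/-- The SINR upper bound at terminal 1,
`γ₀ / (Γ_T + 1) + min (γ₁ / (Γ_T + 1)) (ω₂ γ₂ / (Γ_R + ω₁ Γ_T + ω₁ + 1))`, as a function of
the instantaneous powers `γ₀, γ₁, γ₂` and the interference powers `Γ_T`, `Γ_R`. -/
def sinrUB (ω₁ ω₂ γ₀ γ₁ γ₂ ΓT ΓR : ℝ) : ℝ :=
  γ₀ / (ΓT + 1) + min (γ₁ / (ΓT + 1)) (ω₂ * γ₂ / (ΓR + ω₁ * ΓT + ω₁ + 1))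

/-- The lower incomplete gamma function `∫₀ˣ t^(s-1) e^(-t) dt`. It is used at positive integers
`s` only, where it makes sense for every real `x`. -/
def lowerGamma (s x : ℝ) : ℝ := ∫ t in (0 : ℝ)..x, t ^ (s - 1) * Real.exp (-t)

/-- The coefficients of the hypoexponential density `t ↦ ∑ₖ φₖ exp (-t / ξₖ)` of a sum of
independent exponential variables with distinct means `ξₖ`. -/
def phi {L : ℕ} (ξ : Fin L → ℝ) (k : Fin L) : ℝ :=
  1 / ξ k * ∏ i ∈ Finset.univ.erase k, ξ k / (ξ k - ξ i)

/-- The numbers that enter the distribution function: the power allocation numbers `ω₁, ω₂`, the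
mean powers `g₀, g₁, g₂` of the three links, and the mean interference powers at terminal 1
(`ξT`) and at the relay (`ξR`). -/
structure Parameters (LT LR : ℕ) where
  ω₁ : ℝ
  ω₂ : ℝ
  g₀ : ℝ
  g₁ : ℝ
  g₂ : ℝ
  ξT : Fin LT → ℝ
  ξR : Fin LR → ℝ

namespace Parameters

variable {LT LR : ℕ} (S : Parameters LT LR)

/-- `Φᵢ` for `i = 1, 2`. -/
def Phi (i : ℕ) : ℝ :=
  1 / S.g₀ - 1 / S.g₁ - (S.ω₁ + i - 1) / (S.ω₂ * S.g₂)

/-- `λᵢ` for `i = 1, 2`. -/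
def lam (i : ℕ) : ℝ :=
  1 / S.g₁ + (S.ω₁ + i - 1) / S.ω₂ * (1 / S.g₂)

/-- `β_{j,k}`. -/
def beta (j : Fin LT) (k : Fin LR) : ℝ :=
  S.ω₂ * S.g₂ * S.Phi 1 / S.ξR k + 1 / S.ξT j

/-- The `l`-th term of the series in `M`. -/
def seriesTerm (ρ₃ ρ₄ ρ₅ γ : ℝ) (l : ℕ) : ℝ :=
  (-1) ^ l * (ρ₃ / (ρ₄ * γ + ρ₅)) ^ (l + 1) * (S.Phi 2 ^ (l + 1))⁻¹
    * lowerGamma (l + 1) (S.Phi 2 * γ)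

/-- The series in `M` converges, i.e. its partial sums `∑_{l < n}` have a finite limit. -/
def SeriesConverges (ρ₃ ρ₄ ρ₅ γ : ℝ) : Prop :=
  Summable (S.seriesTerm ρ₃ ρ₄ ρ₅ γ) (SummationFilter.conditional ℕ)

/-- The function `M(ρ₁, ρ₂, ρ₃, ρ₄, ρ₅)` given by an infinite series; the value of the series is
the limit of its partial sums `∑_{l < n}`. -/
def M (γ : ℝ) (j : Fin LT) (k : Fin LR) (ρ₁ : ℝ) (ρ₂ : ℕ) (ρ₃ ρ₄ ρ₅ : ℝ) : ℝ :=
  ρ₁ * Real.exp (-S.lam 2 * γ) / ρ₃ * ((1 / S.g₀ * γ + S.beta j k) ^ ρ₂)⁻¹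
    * ∑'[SummationFilter.conditional ℕ] l, S.seriesTerm ρ₃ ρ₄ ρ₅ γ l

/-- The integral whose expansion is the series in `M`. -/
def MInt (γ : ℝ) (j : Fin LT) (k : Fin LR) (ρ₁ : ℝ) (ρ₂ : ℕ) (ρ₃ ρ₄ ρ₅ : ℝ) : ℝ :=
  ρ₁ * Real.exp (-S.lam 2 * γ) * ((1 / S.g₀ * γ + S.beta j k) ^ ρ₂)⁻¹
    * ∫ z in (0 : ℝ)..γ, Real.exp (-S.Phi 2 * z) / (ρ₃ * z + ρ₄ * γ + ρ₅)

/-- The function `Λ(ρ₁, ρ₂)`. -/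
def Lam (γ : ℝ) (j : Fin LT) (k : Fin LR) (ρ₁ ρ₂ : ℝ) : ℝ :=
  S.g₂ / (1 / S.g₀ * γ + S.beta j k) * (1 / (ρ₁ * γ + 1 / S.ξT j)) * Real.exp (-ρ₂ * γ)

/-- The closed form of the distribution function, with the function to be used for `M` as an
argument. -/
def cdfFormula (γ : ℝ)
    (M : Fin LT → Fin LR → (ρ₁ : ℝ) → (ρ₂ : ℕ) → (ρ₃ ρ₄ ρ₅ : ℝ) → ℝ) : ℝ :=
  1 - Real.exp (-γ / S.g₀) * ∑ j, phi S.ξT j * (S.g₀ / (γ + S.g₀ / S.ξT j))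
    - S.ω₂ / S.g₀ * ∑ j, ∑ k, phi S.ξT j * phi S.ξR k *
      (M j k 1 1 (-(1 / S.g₂)) (1 / S.g₂) (S.ω₂ / S.ξR k)
        + M j k 1 2 (-(1 / S.g₂)) (1 / S.g₂) (S.ω₂ / S.ξR k)
        + M j k (1 / S.ω₂) 1 (S.Phi 1) (S.lam 1) (1 / S.ξT j)
        + M j k (S.Phi 1 * S.g₂) 2 (S.Phi 1) (S.lam 1) (1 / S.ξT j)
        + S.Lam γ j k (S.lam 1) (S.lam 2)
        - S.Lam γ j k (1 / S.g₀) (1 / S.g₀))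

end Parameters

end TwoWayRelay

end

/-!
Rayleigh fading makes the link powers `γ₀, γ₁, γ₂` exponential. Given the interference powers
`Γ_T = x` and `Γ_R = y`, the SINR bound is a sum `A + B` of independent exponential variables, `B`
being a minimum of two, so that `P(A + B > γ) = P(A > γ) + ∫₀^γ f_A(γ - z) P(B > z) dz`
(`expMeasure_prod_add_min_tail`). The integrand is `x + 1` times an exponential of an affine
function of `x` and `y`; averaging it (`sinrUB_tail`) therefore only needs the Laplace transforms
of `Γ_T` and `Γ_R` and the derivative of the former. These are products of factors
`1 / (1 + s ξₖ)`, and their partial fraction expansions have the coefficients `φₖ`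
(`prod_div_eq_sum_phi`); the density of the interference is never used.

What is left is `∫₀^γ e^{-Φ₂ z} (1/p + 1/p²) / q dz` with `p`, `q` affine in `z` and
`Φ₁ g₂ q + p = γ / g₀ + β_{j,k}` constant. Partial fractions and one integration by parts, which
produces the `Λ`-terms, give the closed form with integrals (`integral_partial_fractions`,
`Parameters.cdfFormula_MInt`).

Each remaining integral is `∫₀^γ e^{-k z} / (1 + r z) dz` up to a constant. Its expansion in powers
of `r z` is the series in `M`; when `-1 < r γ`, dominated convergence gives convergence of the
partial sums for `r γ ≤ 1`, endpoint included (`hasSum_alternating_integral`), and for `r γ > 1` the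
terms do not tend to zero (`not_summable_alternating_integral`). The condition `-1 < r γ` always
holds, since it says that the affine denominator is positive at `z = γ`.
-/

namespace TwoWayRelay

/-! ### The exponential distribution -/

theorem expMeasure_real_Ioi {r t : ℝ} (hr : 0 < r) (ht : 0 ≤ t) :
    (expMeasure r).real (Set.Ioi t) = Real.exp (-(r * t)) := by
  have := isProbabilityMeasure_expMeasure hr
  have h := cdf_expMeasure_eq hr t
  rw [cdf_eq_real, if_pos ht] at h
  rw [← Set.compl_Iic, probReal_compl_eq_one_sub measurableSet_Iic, h]
  ring

theorem expMeasure_ae_pos {r : ℝ} (hr : 0 < r) : ∀ᵐ x ∂(expMeasure r), 0 < x := by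
  have := isProbabilityMeasure_expMeasure hr
  have h := expMeasure_real_Ioi hr le_rfl
  rw [mul_zero, neg_zero, Real.exp_zero] at h
  rw [measureReal_def, ENNReal.toReal_eq_one_iff] at h
  exact (mem_ae_iff_prob_eq_one measurableSet_Ioi).mpr h

theorem integral_expMeasure {r : ℝ} (hr : 0 < r) (f : ℝ → ℝ) :
    ∫ x, f x ∂(expMeasure r) = ∫ x in Set.Ioi 0, r * Real.exp (-(r * x)) * f x := by
  have hm : Measurable (exponentialPDF r) := (measurable_exponentialPDFReal r).ennreal_ofReal
  change ∫ x, f x ∂(volume.withDensity (exponentialPDF r)) = _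
  rw [integral_withDensity_eq_integral_toReal_smul hm (by simp [exponentialPDF]),
    ← integral_indicator measurableSet_Ioi]
  refine integral_congr_ae ?_
  filter_upwards [Measure.ae_ne volume 0] with x hx
  rcases lt_or_gt_of_ne hx with h | h
  · simp [exponentialPDF_of_neg h, Set.indicator, h.not_gt]
  · rw [exponentialPDF_of_nonneg h.le, ENNReal.toReal_ofReal (by positivity)]
    simp [Set.indicator, h]

theorem integrable_expMeasure_iff {r : ℝ} (hr : 0 < r) (f : ℝ → ℝ) :
    Integrable f (expMeasure r) ↔
      IntegrableOn (fun x => r * Real.exp (-(r * x)) * f x) (Set.Ioi 0) := by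
  have hm : Measurable (exponentialPDF r) := (measurable_exponentialPDFReal r).ennreal_ofReal
  change Integrable f (volume.withDensity (exponentialPDF r)) ↔ _
  rw [integrable_withDensity_iff_integrable_smul' hm (by simp [exponentialPDF]),
    ← integrable_indicator_iff measurableSet_Ioi]
  refine integrable_congr ?_
  filter_upwards [Measure.ae_ne volume 0] with x hx
  rcases lt_or_gt_of_ne hx with h | h
  · simp [exponentialPDF_of_neg h, Set.indicator, h.not_gt]
  · rw [exponentialPDF_of_nonneg h.le, ENNReal.toReal_ofReal (by positivity)]
    simp [Set.indicator, h]

theorem integral_id_expMeasure {r : ℝ} (hr : 0 < r) : ∫ x, x ∂(expMeasure r) = 1 / r := by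
  rw [integral_expMeasure hr]
  have h := Real.integral_rpow_mul_exp_neg_mul_Ioi (a := 2) two_pos hr
  norm_num at h
  rw [setIntegral_congr_fun (g := fun x => r * (x * Real.exp (-(r * x)))) measurableSet_Ioi
    (fun x _ => by ring), integral_const_mul, h]
  field_simp

theorem integrable_id_expMeasure {r : ℝ} (hr : 0 < r) :
    Integrable (fun x : ℝ => x) (expMeasure r) := by
  refine Integrable.of_integral_ne_zero ?_
  rw [integral_id_expMeasure hr]
  positivity

theorem integral_exp_neg_expMeasure {r s : ℝ} (hr : 0 < r) (hs : -r < s) :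
    ∫ x, Real.exp (-s * x) ∂(expMeasure r) = r / (r + s) := by
  rw [integral_expMeasure hr, setIntegral_congr_fun
    (g := fun x => r * (Real.exp (-(r + s) * x))) measurableSet_Ioi
    (fun x _ => by simp only [mul_assoc, ← Real.exp_add]; congr 2; ring), integral_const_mul,
    integral_exp_mul_Ioi (by linarith)]
  simp only [mul_zero, Real.exp_zero]
  have : r + s ≠ 0 := by linarith
  field_simp

/-! ### The power of a circularly symmetric Gaussian -/

/-- The law `CN(0, v)` has density `exp (-(x² + y²) / v) / (π v)` on the plane. -/
theorem lintegral_complexGaussian {v : ℝ≥0} (hv : 0 < v) {f : ℂ → ENNReal} (hf : Measurable f) :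
    ∫⁻ z, f z ∂(complexGaussian v) =
      ∫⁻ x : ℝ × ℝ, ENNReal.ofReal (1 / (Real.pi * v) * Real.exp (-(x.1 ^ 2 + x.2 ^ 2) / v))
        * f ⟨x.1, x.2⟩ := by
  have hv2 : v / 2 ≠ 0 := by positivity
  have hm : Measurable (fun p : ℝ × ℝ => (⟨p.1, p.2⟩ : ℂ)) :=
    Complex.measurableEquivRealProd.symm.measurable
  rw [complexGaussian, lintegral_map hf hm, gaussianReal_of_var_ne_zero _ hv2,
    prod_withDensity (by fun_prop) (by fun_prop),
    lintegral_withDensity_eq_lintegral_mul _ (by fun_prop) (by fun_prop)]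
  refine lintegral_congr fun x => ?_
  simp only [Pi.mul_apply, gaussianPDF]
  rw [← ENNReal.ofReal_mul (gaussianPDFReal_nonneg _ _ _)]
  congr 2
  simp only [gaussianPDFReal]
  have hv' : (0 : ℝ) < v := by exact_mod_cast hv
  rw [mul_mul_mul_comm, ← Real.exp_add, ← mul_inv, Real.mul_self_sqrt (by positivity)]
  push_cast
  congr 2
  · field_simp
  · field_simp; ring

/-- In polar coordinates the angle integrates to `2π` and the radial density has the
elementary primitive `r ↦ -exp (-r² / v) / (2π)`. -/
theorem complexGaussian_power_Ioi {v : ℝ≥0} (hv : 0 < v) {p t : ℝ} (hp : 0 < p) (ht : 0 ≤ t) :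
    complexGaussian v {z | t < power p z} = ENNReal.ofReal (Real.exp (-(1 / (p * v) * t))) := by
  have hv' : (0 : ℝ) < v := by exact_mod_cast hv
  have hms : MeasurableSet {z : ℂ | t < power p z} := by
    unfold power; exact measurableSet_lt (by fun_prop) (by fun_prop)
  rw [← lintegral_indicator_one hms,
    lintegral_complexGaussian hv (measurable_one.indicator hms), ← lintegral_comp_polarCoord_symm]
  -- the event is `r > s` for the radius `r`
  set s := Real.sqrt (t / p) with hs
  have hset : ∀ q ∈ polarCoord.target,
      ENNReal.ofReal q.1 • (ENNReal.ofReal (1 / (Real.pi * v) * Real.exp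
        (-((polarCoord.symm q).1 ^ 2 + (polarCoord.symm q).2 ^ 2) / v))
        * Set.indicator {z : ℂ | t < power p z} 1 ⟨(polarCoord.symm q).1, (polarCoord.symm q).2⟩) =
      (Set.Ioi s).indicator (fun r => ENNReal.ofReal
        (1 / (Real.pi * v) * (r * Real.exp (-r ^ 2 / v)))) q.1 * 1 := by
    rintro ⟨r, θ⟩ ⟨hr, -⟩
    have hr : 0 < r := hr
    have h1 : (r * Real.cos θ) ^ 2 + (r * Real.sin θ) ^ 2 = r ^ 2 := by
      linear_combination r ^ 2 * Real.sin_sq_add_cos_sq θ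
    have h2 : (⟨r * Real.cos θ, r * Real.sin θ⟩ : ℂ) ∈ {z : ℂ | t < power p z} ↔ r ∈ Set.Ioi s := by
      simp only [Set.mem_ofPred_eq, power, Complex.sq_norm, Complex.normSq_mk, Set.mem_Ioi, hs]
      rw [Real.sqrt_lt' hr, div_lt_iff₀' hp, ← sq, ← sq, h1]
    simp only [polarCoord_symm_apply, h1]
    by_cases h : r ∈ Set.Ioi s
    · rw [Set.indicator_of_mem (h2.mpr h), Set.indicator_of_mem h, smul_eq_mul, Pi.one_apply,
        mul_one, mul_one, ← ENNReal.ofReal_mul hr.le]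
      congr 1; ring
    · rw [Set.indicator_of_notMem (mt h2.mp h), Set.indicator_of_notMem h]
      simp
  rw [setLIntegral_congr_fun polarCoord.open_target.measurableSet hset, polarCoord_target,
    Measure.volume_eq_prod, ← Measure.prod_restrict, lintegral_prod_mul (f := (Set.Ioi s).indicator
      fun r => ENNReal.ofReal (1 / (Real.pi * v) * (r * Real.exp (-r ^ 2 / v)))) (g := fun _ => 1)
      (Measurable.indicator (by fun_prop) measurableSet_Ioi).aemeasurable (by fun_prop),
    lintegral_indicator measurableSet_Ioi, Measure.restrict_restrict measurableSet_Ioi,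
    Set.inter_eq_left.mpr (Set.Ioi_subset_Ioi (Real.sqrt_nonneg _))]
  have hderiv : ∀ x ∈ Set.Ici s, HasDerivAt (fun r => -(1 / (2 * Real.pi)) * Real.exp (-r ^ 2 / v))
      (1 / (Real.pi * v) * (x * Real.exp (-x ^ 2 / v))) x := by
    intro x _
    have := (((hasDerivAt_pow 2 x).neg.div_const (v : ℝ)).exp).const_mul (-(1 / (2 * Real.pi)))
    convert! this using 1
    simp; field_simp
  have hnn : ∀ x ∈ Set.Ioi s, 0 ≤ 1 / (Real.pi * v) * (x * Real.exp (-x ^ 2 / v)) := by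
    intro x hx
    have : 0 < x := (Real.sqrt_nonneg _).trans_lt hx
    positivity
  have hlim : Filter.Tendsto (fun r : ℝ => -(1 / (2 * Real.pi)) * Real.exp (-r ^ 2 / v))
      Filter.atTop (nhds (-(1 / (2 * Real.pi)) * 0)) := by
    refine Filter.Tendsto.const_mul _ (Real.tendsto_exp_atBot.comp ?_)
    simp only [neg_div]
    exact Filter.tendsto_neg_atTop_atBot.comp
      ((Filter.tendsto_pow_atTop two_ne_zero).atTop_div_const hv')
  rw [← ofReal_integral_eq_lintegral_ofReal
    (integrableOn_Ioi_deriv_of_nonneg' hderiv hnn hlim)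
    ((ae_restrict_iff' measurableSet_Ioi).mpr (ae_of_all _ hnn)),
    integral_Ioi_of_hasDerivAt_of_nonneg' hderiv hnn hlim, lintegral_one,
    Measure.restrict_apply_univ, Real.volume_Ioo, ← ENNReal.ofReal_mul]
  · congr 1
    rw [hs, Real.sq_sqrt (by positivity)]
    have := Real.pi_pos
    field_simp
    ring_nf
  · have := Real.pi_pos
    simp; positivity

theorem isProbabilityMeasure_complexGaussian (v : ℝ≥0) :
    IsProbabilityMeasure (complexGaussian v) :=
  Measure.isProbabilityMeasure_map Complex.measurableEquivRealProd.symm.measurable.aemeasurable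

theorem measurable_power (p : ℝ) : Measurable (power p) := by
  unfold power; fun_prop

theorem complexGaussian_map_power {v : ℝ≥0} (hv : 0 < v) {p : ℝ} (hp : 0 < p) :
    (complexGaussian v).map (power p) = expMeasure (1 / (p * v)) := by
  have hv' : (0 : ℝ) < v := by exact_mod_cast hv
  have hr : 0 < 1 / (p * v) := by positivity
  have := isProbabilityMeasure_expMeasure hr
  have := isProbabilityMeasure_complexGaussian v
  have := Measure.isProbabilityMeasure_map (μ := complexGaussian v) (measurable_power p).aemeasurable
  refine Measure.eq_of_cdf _ _ (StieltjesFunction.ext fun t => ?_)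
  rw [cdf_expMeasure_eq hr, cdf_eq_real]
  split_ifs with ht
  · rw [← Set.compl_Ioi, probReal_compl_eq_one_sub measurableSet_Ioi,
      map_measureReal_apply (measurable_power p) measurableSet_Ioi, measureReal_def]
    change 1 - (complexGaussian v {z | t < power p z}).toReal = _
    rw [complexGaussian_power_Ioi hv hp ht, ENNReal.toReal_ofReal (Real.exp_pos _).le]
  · rw [map_measureReal_apply (measurable_power p) measurableSet_Iic]
    convert measureReal_empty using 2
    ext z
    have : 0 ≤ power p z := by unfold power; positivity
    simp; linarith

/-- Rayleigh fading: the received power is exponential with mean `p v`. -/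
theorem hasLaw_power {Ω : Type*} [MeasurableSpace Ω] {μ : Measure Ω} {c : Ω → ℂ} {v : ℝ≥0}
    (hc : HasLaw c (complexGaussian v) μ) (hv : 0 < v) {p : ℝ} (hp : 0 < p) :
    HasLaw (fun ω => power p (c ω)) (expMeasure (1 / (p * v))) μ :=
  HasLaw.fun_comp ⟨(measurable_power p).aemeasurable, complexGaussian_map_power hv hp⟩ hc

theorem integral_power {Ω : Type*} [MeasurableSpace Ω] {μ : Measure Ω} {c : Ω → ℂ} {v : ℝ≥0}
    (hc : HasLaw c (complexGaussian v) μ) (hv : 0 < v) {p : ℝ} (hp : 0 < p) :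
    ∫ ω, power p (c ω) ∂μ = p * v := by
  have hr : 0 < 1 / (p * (v : ℝ)) := by positivity
  rw [(hasLaw_power hc hv hp).integral_eq, integral_id_expMeasure hr, one_div_one_div]

/-! ### The Laplace transform of the interference power -/

/-- Partial fraction expansion of the Laplace transform of a hypoexponential law. It is the
identity that the Lagrange basis polynomials at the nodes `-1 / ξₖ` sum to `1`, divided by the
nodal polynomial. -/
theorem prod_div_eq_sum_phi {L : ℕ} (hL : 0 < L) {ξ : Fin L → ℝ} (hpos : ∀ k, 0 < ξ k)
    (hinj : Function.Injective ξ) {s : ℝ} (hs : 0 ≤ s) :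
    ∏ k, 1 / ξ k / (1 / ξ k + s) = ∑ k, phi ξ k / (s + 1 / ξ k) := by
  have hne : (Finset.univ : Finset (Fin L)).Nonempty := ⟨⟨0, hL⟩, Finset.mem_univ _⟩
  have hne0 : ∀ k, ξ k ≠ 0 := fun k => (hpos k).ne'
  have hs0 : ∀ k, s + 1 / ξ k ≠ 0 := fun k => by have := hpos k; positivity
  have hinj' : Set.InjOn (fun k => -(1 / ξ k)) (Finset.univ : Finset (Fin L)) := by
    intro a _ b _ h
    apply hinj
    simpa using h
  have hl := congrArg (Polynomial.eval s) (Lagrange.sum_basis hinj' hne)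
  rw [Polynomial.eval_finsetSum, Polynomial.eval_one] at hl
  have hprod : ∏ k, 1 / ξ k / (1 / ξ k + s) =
      (∏ k, 1 / ξ k / (1 / ξ k + s)) *
        ∑ k, (Lagrange.basis Finset.univ (fun k => -(1 / ξ k)) k).eval s := by
    rw [hl, mul_one]
  rw [hprod, Finset.mul_sum]
  refine Finset.sum_congr rfl fun k _ => ?_
  rw [Lagrange.basis, Polynomial.eval_prod, ← Finset.mul_prod_erase _ _ (Finset.mem_univ k),
    mul_assoc, ← Finset.prod_mul_distrib, phi, mul_div_right_comm, add_comm s]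
  congr 1
  refine Finset.prod_congr rfl fun i hi => ?_
  have hik : ξ k - ξ i ≠ 0 := sub_ne_zero.mpr (hinj.ne (Finset.ne_of_mem_erase hi).symm)
  have hi0 := hne0 i
  have hk0 := hne0 k
  have hsi := hs0 i
  rw [add_comm] at hsi
  have h3 : -(1 / ξ k) - -(1 / ξ i) = (ξ k - ξ i) / (ξ k * ξ i) := by field_simp; ring
  simp only [Lagrange.basisDivisor, Polynomial.eval_mul, Polynomial.eval_C, Polynomial.eval_sub,
    Polynomial.eval_X, h3]
  rw [sub_neg_eq_add, add_comm s, inv_div]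
  have hk : (1 / ξ i + s) / (1 / ξ i + s) = 1 := div_self hsi
  calc _ = (1 / ξ i * (ξ k * ξ i / (ξ k - ξ i))) * ((1 / ξ i + s) / (1 / ξ i + s)) := by ring
    _ = _ := by rw [hk]; field_simp

variable {Ω : Type*} [MeasurableSpace Ω] {μ : Measure Ω}

theorem interference_nonneg {L : ℕ} {p : ℝ} (hp : 0 < p) (c : Fin L → ℂ) :
    0 ≤ interference p c :=
  Finset.sum_nonneg fun k _ => by unfold power; positivity

theorem integral_exp_interference [IsProbabilityMeasure μ] {L : ℕ} (hL : 0 < L) {p : ℝ} (hp : 0 < p)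
    {v : Fin L → ℝ≥0} (hv : ∀ k, 0 < v k) {c : Fin L → Ω → ℂ}
    (hlaw : ∀ k, HasLaw (c k) (complexGaussian (v k)) μ) (hindep : iIndepFun c μ)
    (hinj : Function.Injective fun k => p * (v k : ℝ)) {s : ℝ} (hs : 0 ≤ s) :
    ∫ ω, Real.exp (-s * interference p fun k => c k ω) ∂μ =
      ∑ k, phi (fun k => p * (v k : ℝ)) k / (s + 1 / (p * v k)) := by
  have hpos : ∀ k, 0 < p * (v k : ℝ) := fun k => by have := hv k; positivity
  rw [← prod_div_eq_sum_phi hL hpos hinj hs]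
  have hi : iIndepFun (fun k ω => power p (c k ω)) μ :=
    hindep.comp (fun _ => power p) fun _ => measurable_power p
  have hm := hi.mgf_sum₀ (t := -s) (fun k => (hasLaw_power (hlaw k) (hv k) hp).aemeasurable)
    Finset.univ
  simp only [mgf, Finset.sum_apply] at hm
  change ∫ ω, Real.exp (-s * ∑ k, power p (c k ω)) ∂μ = _
  rw [hm]
  refine Finset.prod_congr rfl fun k _ => ?_
  have hr : 0 < 1 / (p * (v k : ℝ)) := by have := hpos k; positivity
  rw [← integral_exp_neg_expMeasure hr (by linarith)]
  exact (hasLaw_power (hlaw k) (hv k) hp).integral_comp (f := fun x => Real.exp (-s * x))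
    (by fun_prop)

theorem integrable_interference {L : ℕ} {p : ℝ} (hp : 0 < p)
    {v : Fin L → ℝ≥0} (hv : ∀ k, 0 < v k) {c : Fin L → Ω → ℂ}
    (hlaw : ∀ k, HasLaw (c k) (complexGaussian (v k)) μ) :
    Integrable (fun ω => interference p fun k => c k ω) μ := by
  refine integrable_finsetSum _ fun k _ => ?_
  have h := hasLaw_power (hlaw k) (hv k) hp
  have hi := integrable_id_expMeasure (r := 1 / (p * v k)) (by have := hv k; positivity)
  rw [← h.map_eq] at hi
  exact hi.comp_aemeasurable h.aemeasurable

/-- The first derivative of a Laplace transform which is a sum of simple fractions. The expansion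
is only required for `s ≥ 0`, where all integrals converge because `X ≥ 0`. -/
theorem integral_mul_exp_of_laplace [IsProbabilityMeasure μ] {X : Ω → ℝ} (hX : AEMeasurable X μ)
    (hX0 : 0 ≤ᵐ[μ] X)
    {ι : Type*} [Fintype ι] {a b : ι → ℝ} (hb : ∀ k, 0 < b k)
    (hL : ∀ s, 0 ≤ s → ∫ ω, Real.exp (-s * X ω) ∂μ = ∑ k, a k / (s + b k)) {s : ℝ} (hs : 0 < s) :
    ∫ ω, X ω * Real.exp (-s * X ω) ∂μ = ∑ k, a k / (s + b k) ^ 2 := by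
  have hsub : Set.Iic 0 ⊆ integrableExpSet X μ := by
    intro t ht
    refine Integrable.of_bound (by fun_prop) 1 ?_
    filter_upwards [hX0] with ω hω
    rw [Real.norm_eq_abs, Real.abs_exp, Real.exp_le_one_iff]
    exact mul_nonpos_of_nonpos_of_nonneg ht hω
  have hint : -s ∈ interior (integrableExpSet X μ) :=
    interior_mono hsub (by rw [interior_Iic]; simpa using hs)
  have h1 := hasDerivAt_mgf hint
  have h2 : HasDerivAt (fun t => ∑ k, a k / (-t + b k)) (∑ k, a k / (s + b k) ^ 2) (-s) := by
    refine HasDerivAt.fun_sum fun k _ => ?_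
    have hne : - -s + b k ≠ 0 := by have := hb k; linarith
    have := (((hasDerivAt_id (-s)).neg.add_const (b k)).inv hne).const_mul (a k)
    convert! this using 1
    simp [div_eq_mul_inv]
  refine h1.unique (h2.congr_of_eventuallyEq ?_)
  filter_upwards [Iio_mem_nhds (show -s < 0 by linarith)] with t ht
  have := hL (-t) (by simpa using ht.le)
  simpa [mgf] using this

/-! ### The tail of the SINR bound -/

theorem prod_real_apply {α β : Type*} [MeasurableSpace α] [MeasurableSpace β] (μ : Measure α)
    (ν : Measure β) [IsProbabilityMeasure μ] [IsProbabilityMeasure ν] {s : Set (α × β)}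
    (hs : MeasurableSet s) : (μ.prod ν).real s = ∫ x, ν.real (Prod.mk x ⁻¹' s) ∂μ := by
  rw [measureReal_def, Measure.prod_apply hs, ← integral_toReal
    (measurable_measure_prodMk_left hs).aemeasurable (ae_of_all _ fun _ => measure_lt_top _ _)]
  rfl

/-- Scaled independent exponential variables: their minimum is exponential with the sum of the
rates. The truncation `max t 0` covers negative thresholds, where the probability is `1`. -/
theorem expMeasure_prod_min_tail {r₁ r₂ c₁ c₂ : ℝ} (hr₁ : 0 < r₁) (hr₂ : 0 < r₂) (hc₁ : 0 < c₁)
    (hc₂ : 0 < c₂) (t : ℝ) :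
    ((expMeasure r₁).prod (expMeasure r₂)).real {b | t < min (b.1 / c₁) (b.2 / c₂)} =
      Real.exp (-((r₁ * c₁ + r₂ * c₂) * max t 0)) := by
  have := isProbabilityMeasure_expMeasure hr₁
  have := isProbabilityMeasure_expMeasure hr₂
  rcases le_total 0 t with ht | ht
  · have : {b : ℝ × ℝ | t < min (b.1 / c₁) (b.2 / c₂)} =
        Set.Ioi (t * c₁) ×ˢ Set.Ioi (t * c₂) := by
      ext b
      simp [lt_div_iff₀ hc₁, lt_div_iff₀ hc₂]
    rw [this, measureReal_prod_prod, expMeasure_real_Ioi hr₁ (by positivity),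
      expMeasure_real_Ioi hr₂ (by positivity), ← Real.exp_add, max_eq_left ht]
    congr 1; ring
  · rw [max_eq_right ht, mul_zero, neg_zero, Real.exp_zero, measureReal_def,
      ENNReal.toReal_eq_one_iff]
    refine (mem_ae_iff_prob_eq_one (measurableSet_lt (by fun_prop) (by fun_prop))).mp ?_
    filter_upwards [Measure.quasiMeasurePreserving_fst.ae (expMeasure_ae_pos hr₁),
      Measure.quasiMeasurePreserving_snd.ae (expMeasure_ae_pos hr₂)] with b h₁ h₂
    exact ht.trans_lt (lt_min (by positivity) (by positivity))

/-- The tail of the SINR bound for fixed interference powers: condition on the first summand,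
which either exceeds `γ` alone or leaves the threshold `z = γ - a / c₁ ∈ [0, γ]` for the minimum. -/
theorem expMeasure_prod_add_min_tail {r₀ r₁ r₂ c₁ c₂ γ : ℝ} (hr₀ : 0 < r₀) (hr₁ : 0 < r₁)
    (hr₂ : 0 < r₂) (hc₁ : 0 < c₁) (hc₂ : 0 < c₂) (hγ : 0 ≤ γ) :
    ((expMeasure r₀).prod ((expMeasure r₁).prod (expMeasure r₂))).real
      {a | γ < a.1 / c₁ + min (a.2.1 / c₁) (a.2.2 / c₂)} =
      Real.exp (-(r₀ * c₁ * γ)) + ∫ z in (0 : ℝ)..γ,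
        r₀ * c₁ * Real.exp (-(r₀ * c₁ * (γ - z)) - (r₁ * c₁ + r₂ * c₂) * z) := by
  have := isProbabilityMeasure_expMeasure hr₀
  have := isProbabilityMeasure_expMeasure hr₁
  have := isProbabilityMeasure_expMeasure hr₂
  set k := r₁ * c₁ + r₂ * c₂ with hk
  have hk0 : 0 < k := by positivity
  have hsec : ∀ a : ℝ, ((expMeasure r₁).prod (expMeasure r₂)).real (Prod.mk a ⁻¹'
      {a | γ < a.1 / c₁ + min (a.2.1 / c₁) (a.2.2 / c₂)}) =
      Real.exp (-(k * max (γ - a / c₁) 0)) := by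
    intro a
    rw [← expMeasure_prod_min_tail hr₁ hr₂ hc₁ hc₂]
    congr 1
    ext b
    simp only [Set.mem_preimage, Set.mem_ofPred_eq, sub_lt_iff_lt_add']
  rw [prod_real_apply _ _ (measurableSet_lt (by fun_prop) (by fun_prop))]
  simp_rw [hsec]
  set f : ℝ → ℝ := fun a => Real.exp (-(k * max (γ - a / c₁) 0)) with hf
  have hf1 : ∀ a, f a ≤ 1 := fun a => Real.exp_le_one_iff.mpr (by
    have := le_max_right (γ - a / c₁) 0
    nlinarith [mul_nonneg hk0.le this])
  have hfm : Continuous f := by fun_prop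
  have hint : IntegrableOn (fun a => r₀ * Real.exp (-(r₀ * a)) * f a) (Set.Ioi 0) := by
    rw [← integrable_expMeasure_iff hr₀]
    refine Integrable.of_bound hfm.aestronglyMeasurable 1 (ae_of_all _ fun a => ?_)
    rw [Real.norm_eq_abs, Real.abs_exp]
    exact hf1 a
  have hcγ : 0 ≤ c₁ * γ := by positivity
  rw [integral_expMeasure hr₀, ← Set.Ioc_union_Ioi_eq_Ioi hcγ,
    setIntegral_union (Set.Ioc_disjoint_Ioi le_rfl) measurableSet_Ioi
      (hint.mono_set Set.Ioc_subset_Ioi_self) (hint.mono_set (Set.Ioi_subset_Ioi hcγ)), add_comm]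
  congr 1
  · rw [setIntegral_congr_fun (g := fun a => r₀ * Real.exp (-r₀ * a)) measurableSet_Ioi]
    · rw [integral_const_mul, integral_exp_mul_Ioi (by linarith)]
      field_simp
    · intro a ha
      have : γ ≤ a / c₁ := by
        rw [le_div_iff₀ hc₁, mul_comm]; exact le_of_lt ha
      simp [hf, max_eq_right (sub_nonpos.mpr this)]
  · rw [← intervalIntegral.integral_of_le hcγ]
    -- substitution `a = c₁ (γ - z)`
    have hsub := intervalIntegral.integral_comp_sub_mul (a := 0) (b := γ)
      (fun a => r₀ * Real.exp (-(r₀ * a)) * f a) hc₁.ne' (c₁ * γ)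
    simp only [sub_self, mul_zero, sub_zero, smul_eq_mul] at hsub
    rw [eq_inv_mul_iff_mul_eq₀ hc₁.ne'] at hsub
    rw [← hsub, ← intervalIntegral.integral_const_mul]
    refine intervalIntegral.integral_congr fun z hz => ?_
    rw [Set.uIcc_of_le hγ] at hz
    have h1 : γ - (c₁ * γ - c₁ * z) / c₁ = z := by field_simp; ring
    simp only [hf, h1, max_eq_left hz.1]
    rw [sub_eq_add_neg _ (k * z), Real.exp_add]
    ring_nf

theorem measurable_sinrUB (ω₁ ω₂ : ℝ) : Measurable fun q : (ℝ × ℝ) × ℝ × ℝ × ℝ =>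
    sinrUB ω₁ ω₂ q.2.1 q.2.2.1 q.2.2.2 q.1.1 q.1.2 := by
  unfold sinrUB; fun_prop

/-- The tail of the SINR bound, averaged over independent interference powers with laws `νT` and
`νR`. Only `∫ exp (-s x)` and `∫ (x + 1) exp (-s x)` against these laws enter; the factor
`x + 1` is the Jacobian of the substitution in `expMeasure_prod_add_min_tail`. -/
theorem sinrUB_tail {νT νR : Measure ℝ} [IsProbabilityMeasure νT] [IsProbabilityMeasure νR]
    (hT : ∀ᵐ x ∂νT, 0 ≤ x) (hR : ∀ᵐ y ∂νR, 0 ≤ y) (hTi : Integrable (fun x : ℝ => x) νT)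
    {r₀ r₁ r₂ ω₁ ω₂ γ : ℝ} (hr₀ : 0 < r₀) (hr₁ : 0 < r₁) (hr₂ : 0 < r₂) (hω₁ : 0 < ω₁)
    (hω₂ : 0 < ω₂) (hγ : 0 ≤ γ) :
    ((νT.prod νR).prod
      ((expMeasure r₀).prod ((expMeasure r₁).prod (expMeasure r₂)))).real
      {q | γ < sinrUB ω₁ ω₂ q.2.1 q.2.2.1 q.2.2.2 q.1.1 q.1.2} =
      Real.exp (-(r₀ * γ)) * ∫ x, Real.exp (-(r₀ * γ) * x) ∂νT +
      ∫ z in (0 : ℝ)..γ, r₀ * Real.exp (-(r₀ * (γ - z) + r₁ * z + r₂ * (ω₁ + 1) / ω₂ * z)) *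
        ((∫ x, (x + 1) * Real.exp (-(r₀ * (γ - z) + r₁ * z + r₂ * ω₁ / ω₂ * z) * x) ∂νT) *
        ∫ y, Real.exp (-(r₂ / ω₂ * z) * y) ∂νR) := by
  have := isProbabilityMeasure_expMeasure hr₀
  have := isProbabilityMeasure_expMeasure hr₁
  have := isProbabilityMeasure_expMeasure hr₂
  have hTR : ∀ᵐ q ∂(νT.prod νR), 0 ≤ q.1 ∧ 0 ≤ q.2 := by
    filter_upwards [Measure.quasiMeasurePreserving_fst.ae hT,
      Measure.quasiMeasurePreserving_snd.ae hR] with q h₁ h₂ using ⟨h₁, h₂⟩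
  rw [prod_real_apply _ _ (measurableSet_lt measurable_const (measurable_sinrUB ω₁ ω₂))]
  set A : ℝ × ℝ → ℝ := fun q => Real.exp (-(r₀ * (q.1 + 1) * γ)) with hA
  set B : ℝ × ℝ → ℝ → ℝ := fun q z => r₀ * (q.1 + 1) * Real.exp (-(r₀ * (q.1 + 1) * (γ - z)) -
    (r₁ * (q.1 + 1) + r₂ * ((q.2 + ω₁ * q.1 + ω₁ + 1) / ω₂)) * z) with hB
  have hsec : (fun q : ℝ × ℝ => ((expMeasure r₀).prod ((expMeasure r₁).prod (expMeasure r₂))).real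
      (Prod.mk q ⁻¹' {q | γ < sinrUB ω₁ ω₂ q.2.1 q.2.2.1 q.2.2.2 q.1.1 q.1.2}))
      =ᵐ[νT.prod νR] fun q => A q + ∫ z in (0 : ℝ)..γ, B q z := by
    filter_upwards [hTR] with q ⟨h₁, h₂⟩
    simp only [hA, hB]
    rw [← expMeasure_prod_add_min_tail hr₀ hr₁ hr₂ (by positivity) (by positivity) hγ]
    congr 1
    ext a
    simp only [sinrUB, Set.mem_preimage, Set.mem_ofPred_eq]
    rw [div_div_eq_mul_div, mul_comm ω₂]
  have hAint : Integrable A (νT.prod νR) := by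
    refine Integrable.of_bound (by fun_prop) 1 ?_
    filter_upwards [hTR] with q ⟨h₁, h₂⟩
    rw [Real.norm_eq_abs, Real.abs_exp, Real.exp_le_one_iff, neg_nonpos]
    positivity
  have hBint : Integrable (Function.uncurry B) ((νT.prod νR).prod (volume.restrict (Set.Ioc 0 γ))) := by
    -- all exponents are nonpositive, so `r₀ (x + 1)` dominates
    have hd : Integrable (fun q : (ℝ × ℝ) × ℝ => r₀ * (q.1.1 + 1))
        ((νT.prod νR).prod (volume.restrict (Set.Ioc 0 γ))) :=
      (((hTi.add (integrable_const 1)).comp_fst νR).comp_fst _).const_mul r₀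
    refine hd.mono' (by unfold Function.uncurry; fun_prop) ?_
    filter_upwards [Measure.quasiMeasurePreserving_fst.ae hTR,
      Measure.quasiMeasurePreserving_snd.ae (ae_restrict_mem measurableSet_Ioc)] with q ⟨h₁, h₂⟩ hz
    have h0 : 0 ≤ γ - q.2 := sub_nonneg.mpr hz.2
    have hz0 := hz.1
    simp only [Function.uncurry, hB, Real.norm_eq_abs, abs_mul, Real.abs_exp]
    rw [abs_of_pos hr₀, abs_of_nonneg (by positivity)]
    refine mul_le_of_le_one_right (by positivity) (Real.exp_le_one_iff.mpr ?_)
    have e1 : 0 ≤ r₀ * (q.1.1 + 1) * (γ - q.2) := by positivity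
    have e2 : 0 ≤ (r₁ * (q.1.1 + 1) + r₂ * ((q.1.2 + ω₁ * q.1.1 + ω₁ + 1) / ω₂)) * q.2 := by
      positivity
    linarith
  have hBl : Integrable (fun q => ∫ z in Set.Ioc 0 γ, B q z) (νT.prod νR) :=
    hBint.integral_prod_left
  simp_rw [intervalIntegral.integral_of_le hγ] at hsec ⊢
  rw [integral_congr_ae hsec, integral_add hAint hBl,
    integral_integral_swap hBint]
  congr 1
  · rw [← integral_const_mul, integral_prod _ hAint]
    refine integral_congr_ae (ae_of_all _ fun x => ?_)
    simp only [hA, integral_const, probReal_univ, one_smul, ← Real.exp_add]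
    congr 1; ring
  · refine integral_congr_ae (ae_of_all _ fun z => ?_)
    beta_reduce
    rw [← integral_prod_mul, ← integral_const_mul]
    refine integral_congr_ae (ae_of_all _ fun q => ?_)
    have he : -(r₀ * (q.1 + 1) * (γ - z)) -
        (r₁ * (q.1 + 1) + r₂ * ((q.2 + ω₁ * q.1 + ω₁ + 1) / ω₂)) * z =
        -(r₀ * (γ - z) + r₁ * z + r₂ * (ω₁ + 1) / ω₂ * z) +
          (-(r₀ * (γ - z) + r₁ * z + r₂ * ω₁ / ω₂ * z) * q.1 + -(r₂ / ω₂ * z) * q.2) := by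
      field_simp; ring
    simp only [hB]
    rw [he, Real.exp_add, Real.exp_add]
    ring

/-! ### Integrals of exponentials over affine functions -/

theorem affine_pos {a b γ : ℝ} (h0 : 0 < b) (h1 : 0 < a * γ + b) {z : ℝ}
    (hz : z ∈ Set.Icc 0 γ) : 0 < a * z + b := by
  rcases le_total 0 a with ha | ha
  · have := mul_nonneg ha hz.1; linarith
  · have := mul_le_mul_of_nonpos_left hz.2 ha; linarith

theorem continuousOn_exp_div_affine {a b γ : ℝ} (hγ : 0 ≤ γ) (h0 : 0 < b) (h1 : 0 < a * γ + b)
    (k : ℝ) (n : ℕ) :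
    ContinuousOn (fun z => Real.exp (-k * z) / (a * z + b) ^ n) (Set.uIcc 0 γ) := by
  rw [Set.uIcc_of_le hγ]
  exact ContinuousOn.div (by fun_prop) (by fun_prop)
    fun z hz => pow_ne_zero _ (affine_pos h0 h1 hz).ne'

/-- Integration by parts, valid also for `a = 0`; it trades the double pole for a simple one. -/
theorem integral_exp_div_affine_sq {a b γ : ℝ} (hγ : 0 ≤ γ) (h0 : 0 < b) (h1 : 0 < a * γ + b)
    (k : ℝ) :
    a * ∫ z in (0 : ℝ)..γ, Real.exp (-k * z) / (a * z + b) ^ 2 =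
      1 / b - Real.exp (-k * γ) / (a * γ + b) -
        k * ∫ z in (0 : ℝ)..γ, Real.exp (-k * z) / (a * z + b) := by
  have i1 := (continuousOn_exp_div_affine hγ h0 h1 k 1).intervalIntegrable (μ := volume)
  have i2 := (continuousOn_exp_div_affine hγ h0 h1 k 2).intervalIntegrable (μ := volume)
  simp only [pow_one] at i1
  have hd : ∀ z ∈ Set.uIcc 0 γ, HasDerivAt (fun z => -(Real.exp (-k * z) / (a * z + b)))
      (k * (Real.exp (-k * z) / (a * z + b)) + a * (Real.exp (-k * z) / (a * z + b) ^ 2)) z := by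
    intro z hz
    rw [Set.uIcc_of_le hγ] at hz
    have hne := (affine_pos h0 h1 hz).ne'
    have := ((((hasDerivAt_id z).const_mul (-k)).exp).div
      (((hasDerivAt_id z).const_mul a).add_const b) hne).neg
    convert! this using 1
    simp only [id]
    field_simp
    ring
  have h := intervalIntegral.integral_eq_sub_of_hasDerivAt hd
    ((i1.const_mul k).add (i2.const_mul a))
  rw [intervalIntegral.integral_add (i1.const_mul k) (i2.const_mul a),
    intervalIntegral.integral_const_mul, intervalIntegral.integral_const_mul] at h
  simp only [mul_zero, Real.exp_zero, zero_add] at h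
  linarith

/-- With `p = a z + b` and `q = c z + d`, the hypothesis `1 + g c = 0` makes
`D = a g q + p` independent of `z`, so that `1 / (p q) = (a g / p + 1 / q) / D`. -/
theorem integral_partial_fractions {a b c d g γ D : ℝ} (hγ : 0 ≤ γ) (hb : 0 < b)
    (hab : 0 < a * γ + b) (hd : 0 < d) (hcd : 0 < c * γ + d) (hD : D ≠ 0)
    (hac : 1 + g * c = 0) (hbd : D = a * g * d + b) (k : ℝ) :
    ∫ z in (0 : ℝ)..γ, Real.exp (-k * z) * ((1 / (a * z + b) + 1 / (a * z + b) ^ 2)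
        / (c * z + d)) =
      (1 / D + 1 / D ^ 2) * (∫ z in (0 : ℝ)..γ, Real.exp (-k * z) / (c * z + d)) +
      (g * (a - k) / D + a * g / D ^ 2) * (∫ z in (0 : ℝ)..γ, Real.exp (-k * z) / (a * z + b)) +
      g / D * (1 / b - Real.exp (-k * γ) / (a * γ + b)) := by
  have i1 := (continuousOn_exp_div_affine hγ hb hab k 1).intervalIntegrable (μ := volume)
  have i2 := (continuousOn_exp_div_affine hγ hb hab k 2).intervalIntegrable (μ := volume)
  have i3 := (continuousOn_exp_div_affine hγ hd hcd k 1).intervalIntegrable (μ := volume)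
  simp only [pow_one] at i1 i3
  have hcongr : ∫ z in (0 : ℝ)..γ, Real.exp (-k * z) * ((1 / (a * z + b) + 1 / (a * z + b) ^ 2)
        / (c * z + d)) = ∫ z in (0 : ℝ)..γ,
      ((1 / D + 1 / D ^ 2) * (Real.exp (-k * z) / (c * z + d)) +
      (a * g / D + a * g / D ^ 2) * (Real.exp (-k * z) / (a * z + b)) +
      (g * a / D) * (Real.exp (-k * z) / (a * z + b) ^ 2)) := by
    refine intervalIntegral.integral_congr fun z hz => ?_
    rw [Set.uIcc_of_le hγ] at hz
    have hp := (affine_pos hb hab hz).ne'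
    have hq := (affine_pos hd hcd hz).ne'
    have hpq : D = a * g * (c * z + d) + (a * z + b) := by
      rw [hbd]; linear_combination -a * z * hac
    generalize c * z + d = q at *
    generalize a * z + b = p at *
    field_simp
    rw [hpq]
    ring
  rw [hcongr, intervalIntegral.integral_add ((i3.const_mul _).add (i1.const_mul _))
    (i2.const_mul _), intervalIntegral.integral_add (i3.const_mul _) (i1.const_mul _),
    intervalIntegral.integral_const_mul, intervalIntegral.integral_const_mul,
    intervalIntegral.integral_const_mul]
  linear_combination g / D * integral_exp_div_affine_sq hγ hb hab k

/-! ### The series and the integral -/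

/-- The substitution `t = k z`; it also holds for `k ≤ 0`. -/
theorem lowerGamma_succ_mul (k γ : ℝ) (l : ℕ) :
    lowerGamma (l + 1) (k * γ) =
      k ^ (l + 1) * ∫ z in (0 : ℝ)..γ, Real.exp (-k * z) * z ^ l := by
  have h := intervalIntegral.smul_integral_comp_mul_left (a := 0) (b := γ)
    (fun t : ℝ => t ^ ((l : ℝ) + 1 - 1) * Real.exp (-t)) k
  rw [mul_zero] at h
  rw [lowerGamma, ← h, smul_eq_mul, pow_succ', mul_assoc, ← intervalIntegral.integral_const_mul (k ^ l)]
  congr 1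
  refine intervalIntegral.integral_congr fun z _ => ?_
  simp only [add_sub_cancel_right, Real.rpow_natCast, mul_pow, neg_mul]
  ring

/-- Termwise integration of the geometric series of `r / (r z + 1)`. At the endpoint `r γ = 1` the
series only converges conditionally, so the limit is taken along partial sums: their integrands are
dominated by `2 |r| exp (-k z) / (r z + 1)` and converge for every `z ≠ γ`. -/
theorem hasSum_alternating_integral {k r γ : ℝ} (hγ : 0 ≤ γ) (h1 : -1 < r * γ) (h2 : r * γ ≤ 1) :
    HasSum (fun l : ℕ => (-1) ^ l * r ^ (l + 1) * ∫ z in (0 : ℝ)..γ, Real.exp (-k * z) * z ^ l)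
      (r * ∫ z in (0 : ℝ)..γ, Real.exp (-k * z) / (r * z + 1)) (SummationFilter.conditional ℕ) := by
  have hpos : ∀ z ∈ Set.Icc 0 γ, 0 < r * z + 1 := fun z hz =>
    affine_pos one_pos (by linarith) hz
  have hle : ∀ z ∈ Set.Icc 0 γ, r * z ≤ 1 := fun z hz => by
    rcases le_total 0 r with hr | hr
    · exact (mul_le_mul_of_nonneg_left hz.2 hr).trans h2
    · exact (mul_nonpos_of_nonpos_of_nonneg hr hz.1).trans zero_le_one
  have hlt : ∀ z ∈ Set.Icc 0 γ, z ≠ γ → r * z < 1 := fun z hz hzγ => by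
    rcases lt_or_ge 0 r with hr | hr
    · exact (mul_lt_mul_of_pos_left (lt_of_le_of_ne hz.2 hzγ) hr).trans_le h2
    · exact (mul_nonpos_of_nonpos_of_nonneg hr hz.1).trans_lt zero_lt_one
  rw [HasSum, SummationFilter.conditional_filter_eq_map_range, Filter.tendsto_map'_iff]
  have hsum : ∀ n : ℕ, ∑ l ∈ Finset.range n,
      (-1) ^ l * r ^ (l + 1) * ∫ z in (0 : ℝ)..γ, Real.exp (-k * z) * z ^ l =
      ∫ z in (0 : ℝ)..γ, r * Real.exp (-k * z) * ∑ l ∈ Finset.range n, (-(r * z)) ^ l := by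
    intro n
    simp_rw [← intervalIntegral.integral_const_mul]
    rw [← intervalIntegral.integral_finsetSum
      (fun l _ => Continuous.intervalIntegrable (by fun_prop) _ _)]
    refine intervalIntegral.integral_congr fun z _ => ?_
    simp only [Finset.mul_sum]
    refine Finset.sum_congr rfl fun l _ => ?_
    rw [neg_pow (r * z), mul_pow]
    ring
  have hgeom : ∀ z ∈ Set.Icc 0 γ, ∀ n : ℕ,
      ∑ l ∈ Finset.range n, (-(r * z)) ^ l = (1 - (-(r * z)) ^ n) / (r * z + 1) := by
    intro z hz n
    have := hpos z hz
    rw [geom_sum_eq (by linarith), ← neg_div_neg_eq]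
    congr 1 <;> ring
  change Filter.Tendsto (fun n : ℕ => ∑ l ∈ Finset.range n, _) _ _
  simp_rw [hsum, ← intervalIntegral.integral_const_mul]
  refine intervalIntegral.tendsto_integral_filter_of_dominated_convergence
    (fun z => 2 * |r| * (Real.exp (-k * z) / (r * z + 1) ^ 1))
    (Filter.Eventually.of_forall fun n => Continuous.aestronglyMeasurable (by fun_prop))
    (Filter.Eventually.of_forall fun n => ae_of_all _ fun z hz => ?_)
    ((continuousOn_exp_div_affine hγ one_pos (by linarith) k 1).intervalIntegrable.const_mul _) ?_
  · rw [Set.uIoc_of_le hγ] at hz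
    have hz := Set.Ioc_subset_Icc_self hz
    have hp := hpos z hz
    have h3 : |-(r * z)| ≤ 1 := by
      rw [abs_neg, abs_le]; exact ⟨by linarith, hle z hz⟩
    have h4 : |1 - (-(r * z)) ^ n| ≤ 2 := by
      have h5 : |(-(r * z)) ^ n| ≤ 1 := by rw [abs_pow]; exact pow_le_one₀ (abs_nonneg _) h3
      have := abs_le.mp h5
      rw [abs_le]; constructor <;> linarith
    rw [hgeom z hz, Real.norm_eq_abs, abs_mul, abs_mul, Real.abs_exp, abs_div, abs_of_pos hp, pow_one]
    calc |r| * Real.exp (-k * z) * (|1 - (-(r * z)) ^ n| / (r * z + 1))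
        ≤ |r| * Real.exp (-k * z) * (2 / (r * z + 1)) := by gcongr
      _ = _ := by ring
  · filter_upwards [Measure.ae_ne volume γ] with z hzγ hz
    rw [Set.uIoc_of_le hγ] at hz
    have hz := Set.Ioc_subset_Icc_self hz
    have hp := hpos z hz
    have h3 : |-(r * z)| < 1 := by
      rw [abs_neg, abs_lt]; exact ⟨by linarith, hlt z hz hzγ⟩
    simp_rw [hgeom z hz]
    have h := ((tendsto_pow_atTop_nhds_zero_of_abs_lt_one h3).const_sub 1).div_const (r * z + 1)
      |>.const_mul (r * Real.exp (-k * z))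
    convert h using 2
    ring

/-- For `r γ > 1` the terms do not tend to zero: on `[1 / r, γ]` the factor `(r z) ^ l` is at
least `1`. -/
theorem not_summable_alternating_integral {k r γ : ℝ} (hγ : 0 ≤ γ) (h : 1 < r * γ) :
    ¬ Summable (fun l : ℕ => (-1) ^ l * r ^ (l + 1) *
      ∫ z in (0 : ℝ)..γ, Real.exp (-k * z) * z ^ l) (SummationFilter.conditional ℕ) := by
  rintro ⟨s, hs⟩
  rw [HasSum, SummationFilter.conditional_filter_eq_map_range, Filter.tendsto_map'_iff] at hs
  have hr : 0 < r := by
    by_contra hr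
    have := mul_nonpos_of_nonpos_of_nonneg (not_lt.mp hr) hγ
    linarith
  have hrγ : 1 / r < γ := by rwa [div_lt_iff₀' hr]
  have h0 := ((hs.comp (Filter.tendsto_add_atTop_nat 1)).sub hs).norm
  simp only [Function.comp_def, Finset.sum_range_succ, add_sub_cancel_left, sub_self, norm_zero,
    norm_mul, norm_pow, norm_neg, norm_one, one_pow, one_mul] at h0
  have hC : 0 < ∫ z in (1 / r)..γ, r * Real.exp (-k * z) :=
    intervalIntegral.intervalIntegral_pos_of_pos (Continuous.intervalIntegrable (by fun_prop) _ _)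
      (fun z => by positivity) hrγ
  refine hC.not_ge (ge_of_tendsto' h0 fun l => ?_)
  rw [Real.norm_of_nonneg hr.le, Real.norm_of_nonneg (intervalIntegral.integral_nonneg hγ
    fun z hz => by have := hz.1; positivity), ← intervalIntegral.integral_const_mul,
    ← intervalIntegral.integral_add_adjacent_intervals (a := 0) (b := 1 / r)
      (Continuous.intervalIntegrable (by fun_prop) _ _)
      (Continuous.intervalIntegrable (by fun_prop) _ _)]
  refine le_add_of_nonneg_of_le (intervalIntegral.integral_nonneg (by positivity)
    fun z hz => by have := hz.1; positivity) ?_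
  refine intervalIntegral.integral_mono_on hrγ.le (Continuous.intervalIntegrable (by fun_prop) _ _)
    (Continuous.intervalIntegrable (by fun_prop) _ _) fun z hz => ?_
  have h1 : 1 ≤ (r * z) ^ l := one_le_pow₀ ((div_le_iff₀' hr).mp hz.1)
  calc r * Real.exp (-k * z) ≤ r * Real.exp (-k * z) * (r * z) ^ l :=
        le_mul_of_one_le_right (by positivity) h1
    _ = _ := by rw [mul_pow]; ring

namespace Parameters
variable {LT LR : ℕ} (S : Parameters LT LR)

theorem seriesTerm_eq (h : S.Phi 2 ≠ 0) (ρ₃ ρ₄ ρ₅ γ : ℝ) : S.seriesTerm ρ₃ ρ₄ ρ₅ γ =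
    fun l : ℕ => (-1) ^ l * (ρ₃ / (ρ₄ * γ + ρ₅)) ^ (l + 1) *
      ∫ z in (0 : ℝ)..γ, Real.exp (-S.Phi 2 * z) * z ^ l := by
  funext l
  rw [seriesTerm, lowerGamma_succ_mul, mul_assoc _ _⁻¹, inv_mul_cancel_left₀ (pow_ne_zero _ h)]

theorem seriesConverges_iff (h : S.Phi 2 ≠ 0) {ρ₃ ρ₄ ρ₅ γ : ℝ} (hγ : 0 ≤ γ)
    (h0 : 0 < ρ₄ * γ + ρ₅) (h1 : 0 < ρ₃ * γ + (ρ₄ * γ + ρ₅)) :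
    S.SeriesConverges ρ₃ ρ₄ ρ₅ γ ↔ ρ₃ * γ ≤ ρ₄ * γ + ρ₅ := by
  have h2 : ρ₃ / (ρ₄ * γ + ρ₅) * γ ≤ 1 ↔ ρ₃ * γ ≤ ρ₄ * γ + ρ₅ := by
    rw [div_mul_eq_mul_div, div_le_one h0]
  rw [SeriesConverges, seriesTerm_eq S h, ← h2]
  constructor
  · intro hs
    by_contra hlt
    exact not_summable_alternating_integral hγ (not_le.mp hlt) hs
  · intro hle
    refine (hasSum_alternating_integral hγ ?_ hle).summable
    rw [div_mul_eq_mul_div, lt_div_iff₀ h0]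
    linarith

theorem M_eq_MInt (h : S.Phi 2 ≠ 0) {ρ₃ ρ₄ ρ₅ γ : ℝ} (hγ : 0 ≤ γ) (hρ : ρ₃ ≠ 0)
    (h0 : 0 < ρ₄ * γ + ρ₅) (h1 : 0 < ρ₃ * γ + (ρ₄ * γ + ρ₅)) (h2 : ρ₃ * γ ≤ ρ₄ * γ + ρ₅)
    (j : Fin LT) (k : Fin LR) (ρ₁ : ℝ) (ρ₂ : ℕ) :
    S.M γ j k ρ₁ ρ₂ ρ₃ ρ₄ ρ₅ = S.MInt γ j k ρ₁ ρ₂ ρ₃ ρ₄ ρ₅ := by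
  have hs := hasSum_alternating_integral (k := S.Phi 2) (r := ρ₃ / (ρ₄ * γ + ρ₅)) hγ
    (by rw [div_mul_eq_mul_div, lt_div_iff₀ h0]; linarith)
    (by rwa [div_mul_eq_mul_div, div_le_one h0])
  rw [M, MInt, seriesTerm_eq S h, hs.tsum_eq]
  have hI : ∫ z in (0 : ℝ)..γ, Real.exp (-S.Phi 2 * z) / (ρ₃ * z + ρ₄ * γ + ρ₅) =
      1 / (ρ₄ * γ + ρ₅) *
        ∫ z in (0 : ℝ)..γ, Real.exp (-S.Phi 2 * z) / (ρ₃ / (ρ₄ * γ + ρ₅) * z + 1) := by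
    rw [← intervalIntegral.integral_const_mul]
    refine intervalIntegral.integral_congr fun z _ => ?_
    have : ρ₃ * z + ρ₄ * γ + ρ₅ = (ρ₃ / (ρ₄ * γ + ρ₅) * z + 1) * (ρ₄ * γ + ρ₅) := by
      field_simp; ring
    rw [this, div_mul_eq_div_mul_one_div, mul_comm]
  rw [hI]
  field_simp

end Parameters

/-! ### The closed form as a single integral -/

namespace Parameters
variable {LT LR : ℕ} (S : Parameters LT LR)

theorem Phi_one_add_lam_one : S.Phi 1 + S.lam 1 = 1 / S.g₀ := by
  simp only [Phi, lam]; push_cast; ring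

theorem Phi_two_add_lam_two : S.Phi 2 + S.lam 2 = 1 / S.g₀ := by
  simp only [Phi, lam]; push_cast; ring

theorem lam_one_pos (hω₁ : 0 < S.ω₁) (hω₂ : 0 < S.ω₂) (h₁ : 0 < S.g₁) (h₂ : 0 < S.g₂) :
    0 < S.lam 1 := by
  simp only [lam, Nat.cast_one, add_sub_cancel_right]
  positivity

/-- The summand of the closed form belonging to `j` and `k` is one integral, with the denominators
`p = Φ₁ z + λ₁ γ + 1 / ξ_{T,j}` and `q = (γ - z) / g₂ + ω₂ / ξ_{R,k}`. -/
theorem integral_eq_MInt_add_Lam (hω₂ : 0 < S.ω₂) (h₂ : 0 < S.g₂)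
    {γ : ℝ} (hγ : 0 ≤ γ) (j : Fin LT) (k : Fin LR)
    (hb : 0 < S.lam 1 * γ + 1 / S.ξT j)
    (hab : 0 < S.Phi 1 * γ + (S.lam 1 * γ + 1 / S.ξT j))
    (hd : 0 < 1 / S.g₂ * γ + S.ω₂ / S.ξR k)
    (hcd : 0 < -(1 / S.g₂) * γ + (1 / S.g₂ * γ + S.ω₂ / S.ξR k))
    (hD : 1 / S.g₀ * γ + S.beta j k ≠ 0) :
    Real.exp (-S.lam 2 * γ) * (∫ z in (0 : ℝ)..γ, Real.exp (-S.Phi 2 * z) *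
      ((1 / (S.Phi 1 * z + (S.lam 1 * γ + 1 / S.ξT j)) +
        1 / (S.Phi 1 * z + (S.lam 1 * γ + 1 / S.ξT j)) ^ 2) /
        (-(1 / S.g₂) * z + (1 / S.g₂ * γ + S.ω₂ / S.ξR k)))) =
      S.MInt γ j k 1 1 (-(1 / S.g₂)) (1 / S.g₂) (S.ω₂ / S.ξR k)
        + S.MInt γ j k 1 2 (-(1 / S.g₂)) (1 / S.g₂) (S.ω₂ / S.ξR k)
        + S.MInt γ j k (1 / S.ω₂) 1 (S.Phi 1) (S.lam 1) (1 / S.ξT j)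
        + S.MInt γ j k (S.Phi 1 * S.g₂) 2 (S.Phi 1) (S.lam 1) (1 / S.ξT j)
        + S.Lam γ j k (S.lam 1) (S.lam 2)
        - S.Lam γ j k (1 / S.g₀) (1 / S.g₀) := by
  have hbd : 1 / S.g₀ * γ + S.beta j k =
      S.Phi 1 * S.g₂ * (1 / S.g₂ * γ + S.ω₂ / S.ξR k) + (S.lam 1 * γ + 1 / S.ξT j) := by
    rw [beta, ← Phi_one_add_lam_one]
    field_simp
    ring
  have hgk : S.g₂ * (S.Phi 1 - S.Phi 2) = 1 / S.ω₂ := by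
    simp only [Phi]; push_cast; field_simp; ring
  have hpγ : S.Phi 1 * γ + (S.lam 1 * γ + 1 / S.ξT j) = 1 / S.g₀ * γ + 1 / S.ξT j := by
    rw [← Phi_one_add_lam_one]; ring
  have hexp : Real.exp (-(1 / S.g₀) * γ) = Real.exp (-S.lam 2 * γ) * Real.exp (-S.Phi 2 * γ) := by
    rw [← Phi_two_add_lam_two, ← Real.exp_add]; ring_nf
  rw [integral_partial_fractions hγ hb hab hd hcd hD (by field_simp; ring) hbd, hgk, hpγ]
  simp only [MInt, Lam, hexp, add_assoc (S.Phi 1 * _), add_assoc (-(1 / S.g₂) * _)]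
  generalize 1 / S.g₀ * γ + S.beta j k = D
  ring

/-- The closed form with the integral for `M` is one minus the tail in the shape that
`sinrUB_tail` gives it. -/
theorem cdfFormula_MInt (hω₁ : 0 < S.ω₁) (hω₂ : 0 < S.ω₂) (h₀ : 0 < S.g₀) (h₁ : 0 < S.g₁)
    (h₂ : 0 < S.g₂) (hT : ∀ j, 0 < S.ξT j) (hR : ∀ k, 0 < S.ξR k) {γ : ℝ} (hγ : 0 ≤ γ)
    (hD : ∀ j k, 1 / S.g₀ * γ + S.beta j k ≠ 0) :
    S.cdfFormula γ (S.MInt γ) = 1 -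
      (Real.exp (-(1 / S.g₀ * γ)) * ∑ j, phi S.ξT j / (1 / S.g₀ * γ + 1 / S.ξT j) +
      ∫ z in (0 : ℝ)..γ, 1 / S.g₀ *
        Real.exp (-(1 / S.g₀ * (γ - z) + 1 / S.g₁ * z + 1 / S.g₂ * (S.ω₁ + 1) / S.ω₂ * z)) *
        ((∑ j, phi S.ξT j *
          (1 / (1 / S.g₀ * (γ - z) + 1 / S.g₁ * z + 1 / S.g₂ * S.ω₁ / S.ω₂ * z + 1 / S.ξT j) +
          1 / (1 / S.g₀ * (γ - z) + 1 / S.g₁ * z + 1 / S.g₂ * S.ω₁ / S.ω₂ * z + 1 / S.ξT j) ^ 2)) *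
        ∑ k, phi S.ξR k / (1 / S.g₂ / S.ω₂ * z + 1 / S.ξR k))) := by
  have hl := S.lam_one_pos hω₁ hω₂ h₁ h₂
  have hb : ∀ j, 0 < S.lam 1 * γ + 1 / S.ξT j := fun j => by have := hT j; positivity
  have hab : ∀ j, 0 < S.Phi 1 * γ + (S.lam 1 * γ + 1 / S.ξT j) := fun j => by
    have := hT j
    rw [← add_assoc, ← add_mul, Phi_one_add_lam_one]; positivity
  have hd : ∀ k, 0 < 1 / S.g₂ * γ + S.ω₂ / S.ξR k := fun k => by have := hR k; positivity
  have hcd : ∀ k, 0 < -(1 / S.g₂) * γ + (1 / S.g₂ * γ + S.ω₂ / S.ξR k) := fun k => by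
    have := hR k
    rw [← add_assoc, neg_mul, neg_add_cancel, zero_add]; positivity
  set f : Fin LT → Fin LR → ℝ → ℝ := fun j k z => Real.exp (-S.Phi 2 * z) *
    ((1 / (S.Phi 1 * z + (S.lam 1 * γ + 1 / S.ξT j)) +
      1 / (S.Phi 1 * z + (S.lam 1 * γ + 1 / S.ξT j)) ^ 2) /
      (-(1 / S.g₂) * z + (1 / S.g₂ * γ + S.ω₂ / S.ξR k))) with hf
  have hint : ∀ j k, IntervalIntegrable (f j k) volume 0 γ := by
    intro j k
    refine ContinuousOn.intervalIntegrable ?_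
    rw [Set.uIcc_of_le hγ]
    refine ContinuousOn.mul (by fun_prop) (ContinuousOn.div (ContinuousOn.add
      (ContinuousOn.div (by fun_prop) (by fun_prop) fun z hz => ?_)
      (ContinuousOn.div (by fun_prop) (by fun_prop) fun z hz => ?_)) (by fun_prop)
      fun z hz => ?_)
    · exact (affine_pos (hb j) (hab j) hz).ne'
    · exact pow_ne_zero _ (affine_pos (hb j) (hab j) hz).ne'
    · exact (affine_pos (hd k) (hcd k) hz).ne'
  have hfirst : Real.exp (-γ / S.g₀) * ∑ j, phi S.ξT j * (S.g₀ / (γ + S.g₀ / S.ξT j)) =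
      Real.exp (-(1 / S.g₀ * γ)) * ∑ j, phi S.ξT j / (1 / S.g₀ * γ + 1 / S.ξT j) := by
    rw [neg_div, div_eq_inv_mul, ← one_div]
    congr 1
    refine Finset.sum_congr rfl fun j _ => ?_
    have := hT j
    field_simp
  have hpt : ∀ z, 1 / S.g₀ *
      Real.exp (-(1 / S.g₀ * (γ - (γ - z)) + 1 / S.g₁ * (γ - z) +
        1 / S.g₂ * (S.ω₁ + 1) / S.ω₂ * (γ - z))) *
      ((∑ j, phi S.ξT j *
        (1 / (1 / S.g₀ * (γ - (γ - z)) + 1 / S.g₁ * (γ - z) + 1 / S.g₂ * S.ω₁ / S.ω₂ * (γ - z)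
          + 1 / S.ξT j) +
        1 / (1 / S.g₀ * (γ - (γ - z)) + 1 / S.g₁ * (γ - z) + 1 / S.g₂ * S.ω₁ / S.ω₂ * (γ - z)
          + 1 / S.ξT j) ^ 2)) *
      ∑ k, phi S.ξR k / (1 / S.g₂ / S.ω₂ * (γ - z) + 1 / S.ξR k)) =
      ∑ j, ∑ k, S.ω₂ / S.g₀ * (phi S.ξT j * phi S.ξR k * Real.exp (-S.lam 2 * γ)) * f j k z := by
    intro z
    have he : -(1 / S.g₀ * (γ - (γ - z)) + 1 / S.g₁ * (γ - z) +
        1 / S.g₂ * (S.ω₁ + 1) / S.ω₂ * (γ - z)) = -S.lam 2 * γ + -S.Phi 2 * z := by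
      simp only [Phi, lam]; push_cast; field_simp; ring
    have hp : ∀ j, 1 / S.g₀ * (γ - (γ - z)) + 1 / S.g₁ * (γ - z) +
        1 / S.g₂ * S.ω₁ / S.ω₂ * (γ - z) + 1 / S.ξT j =
        S.Phi 1 * z + (S.lam 1 * γ + 1 / S.ξT j) := by
      intro j
      simp only [Phi, lam]; push_cast; field_simp; ring
    have hq : ∀ k, 1 / S.g₂ / S.ω₂ * (γ - z) + 1 / S.ξR k =
        (-(1 / S.g₂) * z + (1 / S.g₂ * γ + S.ω₂ / S.ξR k)) / S.ω₂ := by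
      intro k
      have := (hR k).ne'
      field_simp; ring
    simp_rw [he, hp, hq, Real.exp_add, Finset.sum_mul_sum, Finset.mul_sum]
    refine Finset.sum_congr rfl fun j _ => Finset.sum_congr rfl fun k _ => ?_
    rw [div_div_eq_mul_div]
    simp only [hf]
    ring
  -- reflection `z ↦ γ - z` turns the tail integral into the one of `integral_eq_MInt_add_Lam`
  have hsub := intervalIntegral.integral_comp_sub_left (a := 0) (b := γ) (fun z => 1 / S.g₀ *
      Real.exp (-(1 / S.g₀ * (γ - z) + 1 / S.g₁ * z + 1 / S.g₂ * (S.ω₁ + 1) / S.ω₂ * z)) *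
      ((∑ j, phi S.ξT j *
        (1 / (1 / S.g₀ * (γ - z) + 1 / S.g₁ * z + 1 / S.g₂ * S.ω₁ / S.ω₂ * z + 1 / S.ξT j) +
        1 / (1 / S.g₀ * (γ - z) + 1 / S.g₁ * z + 1 / S.g₂ * S.ω₁ / S.ω₂ * z + 1 / S.ξT j) ^ 2)) *
      ∑ k, phi S.ξR k / (1 / S.g₂ / S.ω₂ * z + 1 / S.ξR k))) γ
  rw [sub_self, sub_zero] at hsub
  simp_rw [hpt] at hsub
  have hint' : ∀ j, IntervalIntegrable (fun z => ∑ k,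
      S.ω₂ / S.g₀ * (phi S.ξT j * phi S.ξR k * Real.exp (-S.lam 2 * γ)) * f j k z) volume 0 γ := by
    intro j
    have := IntervalIntegrable.sum Finset.univ fun k _ => (hint j k).const_mul
      (S.ω₂ / S.g₀ * (phi S.ξT j * phi S.ξR k * Real.exp (-S.lam 2 * γ)))
    simpa only [Finset.sum_fn] using this
  rw [← hsub, cdfFormula, sub_sub, hfirst]
  congr 2
  rw [intervalIntegral.integral_finsetSum fun j _ => hint' j, Finset.mul_sum]
  refine Finset.sum_congr rfl fun j _ => ?_
  rw [intervalIntegral.integral_finsetSum fun k _ => (hint j k).const_mul _, Finset.mul_sum]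
  refine Finset.sum_congr rfl fun k _ => ?_
  rw [intervalIntegral.integral_const_mul, ← S.integral_eq_MInt_add_Lam hω₂ h₂ hγ j k (hb j)
    (hab j) (hd k) (hcd k) (hD j k)]
  ring

end Parameters

/-! ### Independence and the interference laws -/

theorem indepFun_of_iIndepFun_sumElim {Ω E : Type*} [MeasurableSpace Ω] [MeasurableSpace E]
    {μ : Measure Ω} {ι κ : Type*} [Fintype ι] [Fintype κ] {f : ι → Ω → E} {g : κ → Ω → E}
    (hi : iIndepFun (Sum.elim f g) μ) (hf : ∀ i, AEMeasurable (f i) μ)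
    (hg : ∀ k, AEMeasurable (g k) μ) :
    IndepFun (fun ω i => f i ω) (fun ω k => g k ω) μ := by
  have hd : Disjoint ((Finset.univ : Finset ι).map (Function.Embedding.inl (β := κ)))
      ((Finset.univ : Finset κ).map (Function.Embedding.inr (α := ι))) := by
    rw [Finset.disjoint_left]
    simp
  have h := hi.indepFun_finset₀ _ _ hd (by rintro (i | k); exacts [hf i, hg k])
  exact h.comp (φ := fun u (i : ι) => u ⟨Sum.inl i, by simp⟩)
    (ψ := fun u (k : κ) => u ⟨Sum.inr k, by simp⟩)
    (measurable_pi_lambda _ fun i => measurable_pi_apply _)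
    (measurable_pi_lambda _ fun i => measurable_pi_apply _)

theorem measurable_interference {L : ℕ} (p : ℝ) :
    Measurable (interference p : (Fin L → ℂ) → ℝ) :=
  Finset.measurable_fun_sum _ fun k _ => (measurable_power p).comp (measurable_pi_apply k)

section

variable {Ω : Type*} [MeasurableSpace Ω] {μ : Measure Ω} [IsProbabilityMeasure μ]
  {LT LR : ℕ} {P PT PR : ℝ}
  {v : Fin 3 → ℝ≥0} {vT : Fin LT → ℝ≥0} {vR : Fin LR → ℝ≥0}
  {h : Fin 3 → Ω → ℂ} {cT : Fin LT → Ω → ℂ} {cR : Fin LR → Ω → ℂ}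

/-- The joint law of the two interference powers and the three link powers is a product. -/
theorem hasLaw_powers_interferences (hP : 0 < P) (hv : ∀ i, 0 < v i)
    (hlaw : ∀ i, HasLaw (h i) (complexGaussian (v i)) μ)
    (hT : ∀ k, AEMeasurable (cT k) μ) (hR : ∀ k, AEMeasurable (cR k) μ)
    (hindep : iIndepFun (Sum.elim h (Sum.elim cT cR)) μ) :
    HasLaw (fun ω => ((interference PT fun k => cT k ω, interference PR fun k => cR k ω),
        power P (h 0 ω), power P (h 1 ω), power P (h 2 ω)))
      (((μ.map fun ω => interference PT fun k => cT k ω).prod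
          (μ.map fun ω => interference PR fun k => cR k ω)).prod
        ((expMeasure (1 / (P * v 0))).prod
          ((expMeasure (1 / (P * v 1))).prod (expMeasure (1 / (P * v 2)))))) μ := by
  have hh : ∀ i, AEMeasurable (h i) μ := fun i => (hlaw i).aemeasurable
  have hp := fun i => hasLaw_power (hlaw i) (hv i) hP
  have hcR : ∀ k, AEMeasurable (Sum.elim cT cR k) μ := by rintro (k | k); exacts [hT k, hR k]
  have hmT : AEMeasurable (fun ω => interference PT fun k => cT k ω) μ :=
    (measurable_interference PT).comp_aemeasurable (aemeasurable_pi_lambda _ hT)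
  have hmR : AEMeasurable (fun ω => interference PR fun k => cR k ω) μ :=
    (measurable_interference PR).comp_aemeasurable (aemeasurable_pi_lambda _ hR)
  have hih : iIndepFun (fun i ω => power P (h i ω)) μ :=
    (hindep.precomp (g := Sum.inl) Sum.inl_injective).comp (fun _ => power P)
      fun _ => measurable_power P
  have h12 := (hih.indepFun (show (1 : Fin 3) ≠ 2 by decide)).hasLaw_prod (hp 1) (hp 2)
  have h012 := (hih.indepFun_prodMk₀ (fun i => (hp i).aemeasurable) 1 2 0 (by decide)
    (by decide)).symm.hasLaw_prod (hp 0) h12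
  have hTR : IndepFun (fun ω => interference PT fun k => cT k ω)
      (fun ω => interference PR fun k => cR k ω) μ :=
    (indepFun_of_iIndepFun_sumElim (hindep.precomp (g := Sum.inr) Sum.inr_injective) hT hR).comp
      (measurable_interference PT) (measurable_interference PR)
  have hTRlaw := hTR.hasLaw_prod ⟨hmT, rfl⟩ ⟨hmR, rfl⟩
  refine IndepFun.hasLaw_prod hTRlaw h012 ?_
  refine (indepFun_of_iIndepFun_sumElim hindep hh hcR).symm.comp
    (φ := fun u : Fin LT ⊕ Fin LR → ℂ => (interference PT fun k => u (Sum.inl k),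
      interference PR fun k => u (Sum.inr k)))
    (ψ := fun u : Fin 3 → ℂ => (power P (u 0), power P (u 1), power P (u 2))) ?_ ?_
  · exact ((measurable_interference PT).comp (measurable_pi_lambda _ fun k =>
      measurable_pi_apply _)).prodMk ((measurable_interference PR).comp
        (measurable_pi_lambda _ fun k => measurable_pi_apply _))
  · have := measurable_power P
    fun_prop

theorem integral_add_one_mul_exp_interference {L : ℕ} (hL : 0 < L) {p : ℝ} (hp : 0 < p)
    {w : Fin L → ℝ≥0} (hw : ∀ k, 0 < w k) {c : Fin L → Ω → ℂ}
    (hlaw : ∀ k, HasLaw (c k) (complexGaussian (w k)) μ) (hindep : iIndepFun c μ)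
    (hinj : Function.Injective fun k => p * (w k : ℝ)) {s : ℝ} (hs : 0 < s) :
    ∫ ω, ((interference p fun k => c k ω) + 1) * Real.exp (-s * interference p fun k => c k ω) ∂μ =
      ∑ k, phi (fun k => p * (w k : ℝ)) k *
        (1 / (s + 1 / (p * w k)) + 1 / (s + 1 / (p * w k)) ^ 2) := by
  have hm : AEMeasurable (fun ω => interference p fun k => c k ω) μ :=
    (measurable_interference p).comp_aemeasurable
      (aemeasurable_pi_lambda _ fun k => (hlaw k).aemeasurable)
  have h0 : ∀ ω, 0 ≤ interference p fun k => c k ω := fun ω => interference_nonneg hp _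
  have hbound : ∀ ω, ‖Real.exp (-s * interference p fun k => c k ω)‖ ≤ 1 := fun ω => by
    rw [Real.norm_eq_abs, Real.abs_exp, Real.exp_le_one_iff]
    have := mul_nonneg hs.le (h0 ω)
    linarith
  have hEm : AEStronglyMeasurable
      (fun ω => Real.exp (-s * interference p fun k => c k ω)) μ :=
    (Real.measurable_exp.comp_aemeasurable (hm.const_mul (-s))).aestronglyMeasurable
  have hE : Integrable (fun ω => Real.exp (-s * interference p fun k => c k ω)) μ :=
    Integrable.of_bound hEm 1 (ae_of_all _ hbound)
  have hXE : Integrable (fun ω => (interference p fun k => c k ω) *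
      Real.exp (-s * interference p fun k => c k ω)) μ :=
    (integrable_interference hp hw hlaw).mul_bdd (c := 1) hEm (ae_of_all _ hbound)
  simp_rw [add_mul, one_mul]
  rw [integral_add hXE hE, integral_exp_interference hL hp hw hlaw hindep hinj hs.le,
    integral_mul_exp_of_laplace hm (ae_of_all _ h0)
      (fun k => by have := hw k; positivity)
      (fun s hs => integral_exp_interference hL hp hw hlaw hindep hinj hs) hs,
    ← Finset.sum_add_distrib]
  refine Finset.sum_congr rfl fun k _ => ?_
  ring

end

end TwoWayRelay

/-! ### The distribution function of the SINR bound -/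

theorem lemma1
    {Ω : Type*} [MeasurableSpace Ω] (μ : Measure Ω) [IsProbabilityMeasure μ]
    -- numbers of interferers at terminal 1 and at the relay
    {LT LR : ℕ} (hLT : 0 < LT) (hLR : 0 < LR)
    -- transmit powers, power allocation numbers, channel variances
    (P PT PR ω₁ ω₂ : ℝ) (hP : 0 < P) (hPT : 0 < PT) (hPR : 0 < PR)
    (hω₁ : 0 < ω₁) (hω₂ : 0 < ω₂) (hω : ω₁ + ω₂ = 1)
    (v : Fin 3 → ℝ≥0) (vT : Fin LT → ℝ≥0) (vR : Fin LR → ℝ≥0)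
    (hv : ∀ i, 0 < v i) (hvT : ∀ k, 0 < vT k) (hvR : ∀ k, 0 < vR k)
    -- independent Rayleigh fading channels
    (h : Fin 3 → Ω → ℂ) (cT : Fin LT → Ω → ℂ) (cR : Fin LR → Ω → ℂ)
    (hlaw : ∀ i, HasLaw (h i) (TwoWayRelay.complexGaussian (v i)) μ)
    (hlawT : ∀ k, HasLaw (cT k) (TwoWayRelay.complexGaussian (vT k)) μ)
    (hlawR : ∀ k, HasLaw (cR k) (TwoWayRelay.complexGaussian (vR k)) μ)
    (hindep : iIndepFun (Sum.elim h (Sum.elim cT cR)) μ)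
    -- distinct mean interference powers
    (hξT : Function.Injective fun k => PT * (vT k : ℝ))
    (hξR : Function.Injective fun k => PR * (vR k : ℝ)) :
    let S : TwoWayRelay.Parameters LT LR :=
      { ω₁ := ω₁
        ω₂ := ω₂
        g₀ := ∫ ω, TwoWayRelay.power P (h 0 ω) ∂μ
        g₁ := ∫ ω, TwoWayRelay.power P (h 1 ω) ∂μ
        g₂ := ∫ ω, TwoWayRelay.power P (h 2 ω) ∂μ
        ξT := fun k => PT * (vT k : ℝ)
        ξR := fun k => PR * (vR k : ℝ) }
    let Υ : Ω → ℝ := fun ω =>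
      TwoWayRelay.sinrUB ω₁ ω₂
        (TwoWayRelay.power P (h 0 ω)) (TwoWayRelay.power P (h 1 ω))
        (TwoWayRelay.power P (h 2 ω))
        (TwoWayRelay.interference PT fun k => cT k ω)
        (TwoWayRelay.interference PR fun k => cR k ω)
    ∀ γ : ℝ, 0 ≤ γ → (∀ j k, 1 / S.g₀ * γ + S.beta j k ≠ 0) →
      -- the closed form with the series for `M`, and where these series converge
      (S.Phi 1 ≠ 0 → S.Phi 2 ≠ 0 →
        (∀ k, S.SeriesConverges (-(1 / S.g₂)) (1 / S.g₂) (S.ω₂ / S.ξR k) γ) ∧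
        (∀ j, S.SeriesConverges (S.Phi 1) (S.lam 1) (1 / S.ξT j) γ ↔
          S.Phi 1 * γ ≤ S.lam 1 * γ + 1 / S.ξT j) ∧
        ((∀ j, S.Phi 1 * γ ≤ S.lam 1 * γ + 1 / S.ξT j) →
          cdf (μ.map Υ) γ = S.cdfFormula γ (S.M γ))) ∧
      -- the closed form with the integral for `M`, which needs no convergence
      cdf (μ.map Υ) γ = S.cdfFormula γ (S.MInt γ) := by
  intro S Υ γ hγ hD
  have hg₀ : S.g₀ = P * v 0 := TwoWayRelay.integral_power (hlaw 0) (hv 0) hP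
  have hg₁ : S.g₁ = P * v 1 := TwoWayRelay.integral_power (hlaw 1) (hv 1) hP
  have hg₂ : S.g₂ = P * v 2 := TwoWayRelay.integral_power (hlaw 2) (hv 2) hP
  have hv' : ∀ i, (0 : ℝ) < v i := fun i => by exact_mod_cast hv i
  have h₀ : 0 < S.g₀ := hg₀ ▸ mul_pos hP (hv' 0)
  have h₁ : 0 < S.g₁ := hg₁ ▸ mul_pos hP (hv' 1)
  have h₂ : 0 < S.g₂ := hg₂ ▸ mul_pos hP (hv' 2)
  have hST : ∀ j, 0 < S.ξT j := fun j => mul_pos hPT (by exact_mod_cast hvT j)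
  have hSR : ∀ k, 0 < S.ξR k := fun k => mul_pos hPR (by exact_mod_cast hvR k)
  have hb : cdf (μ.map Υ) γ = S.cdfFormula γ (S.MInt γ) := by
    have hlawAll := TwoWayRelay.hasLaw_powers_interferences (PT := PT) (PR := PR) hP hv hlaw
      (fun k => (hlawT k).aemeasurable) (fun k => (hlawR k).aemeasurable) hindep
    rw [← hg₀, ← hg₁, ← hg₂] at hlawAll
    have hmΥ : AEMeasurable Υ μ :=
      (TwoWayRelay.measurable_sinrUB ω₁ ω₂).comp_aemeasurable hlawAll.aemeasurable
    have hmT : AEMeasurable (fun ω => TwoWayRelay.interference PT fun k => cT k ω) μ :=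
      (TwoWayRelay.measurable_interference PT).comp_aemeasurable
        (aemeasurable_pi_lambda _ fun k => (hlawT k).aemeasurable)
    have hmR : AEMeasurable (fun ω => TwoWayRelay.interference PR fun k => cR k ω) μ :=
      (TwoWayRelay.measurable_interference PR).comp_aemeasurable
        (aemeasurable_pi_lambda _ fun k => (hlawR k).aemeasurable)
    have hiTR : iIndepFun (Sum.elim cT cR) μ := hindep.precomp (g := Sum.inr) Sum.inr_injective
    have hiT : iIndepFun cT μ := hiTR.precomp (g := Sum.inl) Sum.inl_injective
    have hiR : iIndepFun cR μ := hiTR.precomp (g := Sum.inr) Sum.inr_injective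
    have := Measure.isProbabilityMeasure_map hmΥ
    have := Measure.isProbabilityMeasure_map hmT
    have := Measure.isProbabilityMeasure_map hmR
    rw [cdf_eq_real, ← Set.compl_Ioi, probReal_compl_eq_one_sub measurableSet_Ioi,
      map_measureReal_apply_of_aemeasurable hmΥ measurableSet_Ioi,
      S.cdfFormula_MInt hω₁ hω₂ h₀ h₁ h₂ hST hSR hγ hD]
    congr 1
    refine (hlawAll.measureReal_eq (p := fun q : (ℝ × ℝ) × ℝ × ℝ × ℝ =>
        γ < TwoWayRelay.sinrUB ω₁ ω₂ q.2.1 q.2.2.1 q.2.2.2 q.1.1 q.1.2)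
      (measurableSet_lt measurable_const (TwoWayRelay.measurable_sinrUB ω₁ ω₂))).trans ?_
    have hTnn : ∀ᵐ x ∂μ.map (fun ω => TwoWayRelay.interference PT fun k => cT k ω), 0 ≤ x :=
      (ae_map_iff hmT measurableSet_Ici).mpr
        (ae_of_all _ fun ω => TwoWayRelay.interference_nonneg hPT _)
    have hRnn : ∀ᵐ x ∂μ.map (fun ω => TwoWayRelay.interference PR fun k => cR k ω), 0 ≤ x :=
      (ae_map_iff hmR measurableSet_Ici).mpr
        (ae_of_all _ fun ω => TwoWayRelay.interference_nonneg hPR _)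
    have hTint : Integrable (fun x : ℝ => x)
        (μ.map fun ω => TwoWayRelay.interference PT fun k => cT k ω) :=
      (integrable_map_measure (by fun_prop) hmT).mpr
        (TwoWayRelay.integrable_interference hPT hvT hlawT)
    rw [TwoWayRelay.sinrUB_tail hTnn hRnn hTint (one_div_pos.mpr h₀) (one_div_pos.mpr h₁)
      (one_div_pos.mpr h₂) hω₁ hω₂ hγ]
    congr 1
    · rw [integral_map hmT (by fun_prop), TwoWayRelay.integral_exp_interference hLT hPT hvT hlawT
        hiT hξT (by positivity)]
    · rw [intervalIntegral.integral_of_le hγ, intervalIntegral.integral_of_le hγ]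
      -- on `(0, γ]` the argument of the Laplace transform is positive, as its derivative requires
      refine setIntegral_congr_fun measurableSet_Ioc fun z hz => ?_
      have hz0 : 0 < z := hz.1
      have hzγ : 0 ≤ γ - z := sub_nonneg.mpr hz.2
      rw [integral_map hmT (by fun_prop), integral_map hmR (by fun_prop),
        TwoWayRelay.integral_add_one_mul_exp_interference hLT hPT hvT hlawT hiT hξT
          (by positivity),
        TwoWayRelay.integral_exp_interference hLR hPR hvR hlawR hiR hξR (by positivity)]
  refine ⟨fun hΦ₁ hΦ₂ => ?_, hb⟩
  have hl := S.lam_one_pos hω₁ hω₂ h₁ h₂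
  have hq : ∀ k, 0 < 1 / S.g₂ * γ + S.ω₂ / S.ξR k := fun k => by
    have := hSR k
    have : 0 < S.ω₂ := hω₂
    positivity
  have hq' : ∀ k, 0 < -(1 / S.g₂) * γ + (1 / S.g₂ * γ + S.ω₂ / S.ξR k) := fun k => by
    have := hSR k
    have : 0 < S.ω₂ := hω₂
    rw [← add_assoc, neg_mul, neg_add_cancel, zero_add]
    positivity
  have hp : ∀ j, 0 < S.lam 1 * γ + 1 / S.ξT j := fun j => by have := hST j; positivity
  have hp' : ∀ j, 0 < S.Phi 1 * γ + (S.lam 1 * γ + 1 / S.ξT j) := fun j => by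
    have := hST j
    rw [← add_assoc, ← add_mul, S.Phi_one_add_lam_one]
    positivity
  have hle : ∀ k, -(1 / S.g₂) * γ ≤ 1 / S.g₂ * γ + S.ω₂ / S.ξR k := fun k =>
    (mul_nonpos_of_nonpos_of_nonneg (by simpa using h₂.le) hγ).trans (hq k).le
  refine ⟨fun k => (S.seriesConverges_iff hΦ₂ hγ (hq k) (hq' k)).mpr (hle k),
    fun j => S.seriesConverges_iff hΦ₂ hγ (hp j) (hp' j), fun hconv => ?_⟩
  rw [hb]
  have hg₂ne : -(1 / S.g₂) ≠ 0 := by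
    have := h₂.ne'
    simpa using this
  unfold TwoWayRelay.Parameters.cdfFormula
  simp only [S.M_eq_MInt hΦ₂ hγ hg₂ne (hq _) (hq' _) (hle _),
    S.M_eq_MInt hΦ₂ hγ hΦ₁ (hp _) (hp' _) (hconv _)]
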